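/- Fix integers $d\ge 3$, $q\ge 2$ and reals $\beta\ge 0$, $B>0$. For a finite graph $G=(V,E)$, the $q$-state Potts model on $G$ is the probability measure $\nu_G$ on $[q]^V$, $[q]=\{1,\dots,q\}$, with $$\nu_G(\underline\sigma)=\frac1{Z_G}\prod_{(ij)\in E}e^{\beta 1\{\sigma_i=\sigma_j\}}\prod_{i\in V}e^{B1\{\sigma_i=1\}} .$$ For $0\le b\le 1$ let $h_b=\frac1q\big(1+(q-1)b,\,1-b,\dots,1-b\big)$, a probability measure on $[q]$ ("of bias $b$"). The belief propagation map $$(\mathsf{BP}\,h)(\sigma)\propto e^{B1\{\sigma=1\}}\Big(\sum_{\sigma'}e^{\beta1\{\sigma=\sigma'\}}h_{\sigma'}\Big)^{d-1}$$ (normalized to a probability measure) maps $\{h_b:0\le b\le1\}$ to itself, hence acts as a map $\mathrm{bp}:[0,1]\to[0,1]$ on the bias; let $b^{\mathrm f}=\lim_{t\to\infty}\mathrm{bp}^{(t)}(0)$ and $b^{\mathrm m}=\lim_{t\to\infty}\mathrm{bp}^{(t)}(1)$. For $\varepsilon\in\mathbb R$ let $\triangle_\varepsilon$ be the set of $h_b$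 with $b\in[0,1]\cap[b^{\mathrm f}-\varepsilon,\,b^{\mathrm m}+\varepsilon]$. For a finite graph $G=(V,E)$ and $t\in\mathbb Z_{\ge0}$ let $\zeta_t(G)$ be the fraction of vertices $v\in V$ for which the subgraph of $G$ induced by the vertices at distance at most $t$ from $v$ is not isomorphic to the ball of radius $t$ around the root of the infinite $d$-regular tree. For a probability measure $\rho$ on $\triangle_\varepsilon^d$ let $\bar\rho(\underline\sigma)=\int\prod_{j=1}^d h^j_{\sigma_j}\,d\rho(h^1,\dots,h^d)$, a mixture of product measures on $[q]^d$. Then there are functions $\varepsilon:\mathbb Z_{\ge0}\to\mathbb R$ and $\mathrm{err}:\mathbb Z_{\ge0}\times[0,\infty)\to\mathbb R$, depending only on $d,q,\beta,B$, such that $\lim_{t\to\infty}\varepsilon(t)=0$; $\mathrm{err}$ is uniformly bounded; for each $t$ the limit of $\mathrm{err}(t,x)$ as $x\downarrow0$ exists and equals $\mathrm{err}(t,0)$; and $\lim_{t\to\infty}\mathrm{err}(t,0)=0$; and such that the following holds. For every finite non-empty simple $d$-regular graph $G=(V,E)$ and every choice of an enumeration $(v_1,\dots,v_d)$ of the neighbours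 of each vertex $v$, there are probability measures $\rho(G,v,t)$ on $\triangle_{\varepsilon(t)}^d$, for all $v\in V$ and $t\in\mathbb Z_{\ge0}$, such that for all $t$ $$\frac1{|V|}\sum_{v\in V}\big\|\nu_{G\setminus v}\big((\sigma_{v_1},\dots,\sigma_{v_d})=\cdot\big)-\bar\rho(G,v,t)\big\|_{\mathrm{TV}}\le \mathrm{err}(t,\zeta_t(G)),$$ where $G\setminus v$ is $G$ with the vertex $v$ (and its edges) removed. -/

import Mathlib

open Filter Topology MeasureTheory

noncomputable section

namespace PottsTree

/-! ### Balls, the `d`-regular tree, and the density of non-tree-like vertices -/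

/-- The subgraph of `G` induced by the vertices at graph distance at most `t` from `v`. -/
abbrev ballGraph {V : Type*} (G : SimpleGraph V) (t : ℕ) (v : V) :
    SimpleGraph {w : V | G.edist v w ≤ (t : ℕ∞)} :=
  G.induce {w : V | G.edist v w ≤ (t : ℕ∞)}

/-- Vertices of the `d`-regular tree: words over `d` letters in which consecutive letters differ.
The children of a word are obtained by adding one letter in front, so that the empty word has `d`
children and every other word has `d - 1` children. -/
abbrev TreeVertex (d : ℕ) : Type := {l : List (Fin d) // l.IsChain (· ≠ ·)}

/-- The root of the `d`-regular tree. -/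
def treeRoot (d : ℕ) : TreeVertex d := ⟨[], List.IsChain.nil⟩

/-- The `d`-regular tree: each non-empty word is joined to the word without its first letter. -/
def regularTree (d : ℕ) : SimpleGraph (TreeVertex d) where
  Adj x y := (∃ a, y.1 = a :: x.1) ∨ (∃ a, x.1 = a :: y.1)
  symm := ⟨fun _ _ h => h.symm⟩
  loopless := ⟨by
    rintro x (⟨a, h⟩ | ⟨a, h⟩) <;> exact absurd (congrArg List.length h) (by simp)⟩

/-- The ball of radius `t` around `v` is isomorphic to the depth-`t` subtree of the `d`-regular
tree. -/
def IsTreeBall {V : Type*} (d : ℕ) (G : SimpleGraph V) (t : ℕ) (v : V) : Prop :=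
  Nonempty (ballGraph G t v ≃g ballGraph (regularTree d) t (treeRoot d))

/-- `ζ_t(G)`: the fraction of vertices whose ball of radius `t` is not isomorphic to the depth-`t`
subtree of the `d`-regular tree. -/
def zeta {V : Type*} [Fintype V] (d t : ℕ) (G : SimpleGraph V) : ℝ :=
  ({v : V | ¬ IsTreeBall d G t v}.ncard : ℝ) / (Fintype.card V : ℝ)

/-! ### The Potts model -/

/-- Edge weight `ψ(s, s') = exp(β 1{s = s'})`. -/
def psi {q : ℕ} (β : ℝ) (s s' : Fin q) : ℝ := Real.exp (β * if s = s' then 1 else 0)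

/-- Vertex weight `exp(B 1{s = 1})`. The `q` spins are the elements of `Fin q`, and the
distinguished spin `1` of the model is the element `0 : Fin q`. -/
def psiBar {q : ℕ} [NeZero q] (B : ℝ) (s : Fin q) : ℝ := Real.exp (B * if s = 0 then 1 else 0)

theorem psi_comm {q : ℕ} (β : ℝ) (s s' : Fin q) : psi β s s' = psi β s' s := by
  simp only [psi, eq_comm]

open Classical in
/-- The unnormalized weight of a spin configuration on a finite graph. -/
def pottsWeight {W : Type*} [Fintype W] {q : ℕ} [NeZero q] (β B : ℝ) (G : SimpleGraph W)
    (σ : W → Fin q) : ℝ :=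
  (∏ e ∈ G.edgeFinset,
      Sym2.lift ⟨fun i j => psi β (σ i) (σ j), fun _ _ => psi_comm β _ _⟩ e)
    * ∏ i : W, psiBar B (σ i)

open Classical in
/-- The partition function. -/
def pottsZ {W : Type*} [Fintype W] (q : ℕ) [NeZero q] (β B : ℝ) (G : SimpleGraph W) : ℝ :=
  ∑ σ : W → Fin q, pottsWeight β B G σ

/-- The probability of a spin configuration in the Potts model on a finite graph. -/
def pottsProb {W : Type*} [Fintype W] {q : ℕ} [NeZero q] (β B : ℝ) (G : SimpleGraph W)
    (σ : W → Fin q) : ℝ :=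
  pottsWeight β B G σ / pottsZ q β B G

open Classical in
/-- The law `ν_{G∖v}(σ_{∂v} = ·)` on `Fin d → Fin q`: in the Potts model on `G` with the vertex
`v` removed, the joint law of the spins at the neighbours of `v` in `G`, listed by `e`. -/
def nuMinus {V : Type*} [Fintype V] {d q : ℕ} [NeZero q] (β B : ℝ) (G : SimpleGraph V) (v : V)
    (e : Fin d ≃ G.neighborSet v) (τ : Fin d → Fin q) : ℝ :=
  ∑ σ : {w : V | w ≠ v} → Fin q,
    if ∀ j : Fin d, σ ⟨(e j : V), (G.ne_of_adj (e j).2).symm⟩ = τ j then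
      pottsProb β B (G.induce {w : V | w ≠ v}) σ
    else 0

/-! ### Belief propagation and the biases `b^f`, `b^m` -/

/-- The belief propagation recursion
`(BP h)(s) ∝ ψ̄(s) (∑_{s'} ψ(s, s') h(s'))^(d-1)`, normalized to total mass one. -/
def BP {q : ℕ} [NeZero q] (d : ℕ) (β B : ℝ) (h : Fin q → ℝ) (s : Fin q) : ℝ :=
  psiBar B s * (∑ s', psi β s s' * h s') ^ (d - 1)
    / ∑ r, psiBar B r * (∑ s', psi β r s' * h s') ^ (d - 1)

/-- The vector `(1/q) (1 + (q-1) b, 1 - b, …, 1 - b)`. -/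
def biasVec (q : ℕ) [NeZero q] (b : ℝ) (s : Fin q) : ℝ :=
  (if s = 0 then 1 + ((q : ℝ) - 1) * b else 1 - b) / q

/-- The univariate recursion: the bias `b'` of `BP h` for `h` of bias `b`, read off from
`(BP h)(1) = (1 + (q-1) b') / q`. -/
def bp (d q : ℕ) [NeZero q] (β B b : ℝ) : ℝ :=
  ((q : ℝ) * BP d β B (biasVec q b) 0 - 1) / ((q : ℝ) - 1)

/-- `b^f`, the limit of the iterates of the recursion started from bias `0`. -/
def biasF (d q : ℕ) [NeZero q] (β B : ℝ) : ℝ :=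
  limUnder atTop (fun t : ℕ => (bp d q β B)^[t] 0)

/-- `b^m`, the limit of the iterates of the recursion started from bias `1`. -/
def biasM (d q : ℕ) [NeZero q] (β B : ℝ) : ℝ :=
  limUnder atTop (fun t : ℕ => (bp d q β B)^[t] 1)

/-- The set of probability vectors `(1/q) (1 + (q-1) b, 1 - b, …, 1 - b)` with `0 ≤ b ≤ 1` and
`b ∈ [b^f - ε, b^m + ε]`. -/
def simplexFK (d q : ℕ) [NeZero q] (β B ε : ℝ) : Set (Fin q → ℝ) :=
  {h | ∃ b : ℝ, 0 ≤ b ∧ b ≤ 1 ∧ biasF d q β B - ε ≤ b ∧ b ≤ biasM d q β B + ε ∧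
    h = biasVec q b}

/-! ### Mixtures of product measures, total variation, error functions -/

/-- The mixture of product measures `ρ̄(τ) = ∫ h¹(τ₁) ⋯ h^d(τ_d) dρ(h)`. -/
def mixture {d q : ℕ} (ρ : Measure (Fin d → Fin q → ℝ)) (τ : Fin d → Fin q) : ℝ :=
  ∫ h, ∏ j : Fin d, h j (τ j) ∂ρ

/-- Total variation distance between two measures on a finite set, given by their masses. -/
def tvDist {Ω : Type*} [Fintype Ω] (μ ν : Ω → ℝ) : ℝ :=
  (1 / 2) * ∑ x, |μ x - ν x|

/-- `f` is of the type `o(t, x)`: uniformly bounded, with `lim_{x ↓ 0} f(t, x) = g(t)` for each `t`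
(the value at `x = 0` included) and `lim_{t → ∞} g(t) = 0`. -/
def IsError (f : ℕ → ℝ → ℝ) : Prop :=
  (∃ C : ℝ, ∀ t x, 0 ≤ x → |f t x| ≤ C) ∧
    ∃ g : ℕ → ℝ, (∀ t, Tendsto (f t) (𝓝[≥] 0) (𝓝 (g t))) ∧ Tendsto g atTop (𝓝 0)

/-! ### The limits defining `b^f` and `b^m` exist -/

/-- The sum `∑ ψ(s, ·) h(·)` for `h` of bias `b`. -/
theorem sum_psi_biasVec {q : ℕ} [NeZero q] (β b : ℝ) (s : Fin q) :
    ∑ s', psi β s s' * biasVec q b s'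
      = 1 + (Real.exp β - 1) * biasVec q b s := by
  have hq0 : (q : ℝ) ≠ 0 := Nat.cast_ne_zero.2 (NeZero.ne q)
  have h1 : ∀ s', psi β s s' * biasVec q b s'
      = biasVec q b s' + if s = s' then (Real.exp β - 1) * biasVec q b s' else 0 := by
    intro s'
    by_cases h : s = s' <;> simp [psi, h] <;> ring
  have h2 : ∑ s', biasVec q b s' = 1 := by
    have h3 : ∀ s' : Fin q, biasVec q b s' = (1 - b) / q + if s' = 0 then b else 0 := by
      intro s'
      by_cases h : s' = 0
      · simp only [biasVec, h, if_true]
        field_simp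
        ring
      · simp [biasVec, h]
    simp only [h3, Finset.sum_add_distrib, Finset.sum_ite_eq', Finset.mem_univ, if_true,
      Finset.sum_const, Finset.card_univ, Fintype.card_fin, nsmul_eq_mul]
    field_simp
    ring
  simp only [h1, Finset.sum_add_distrib, h2, Finset.sum_ite_eq, Finset.mem_univ, if_true]

/-- Closed form of the mass that `BP` gives to the distinguished spin. -/
theorem BP_biasVec_zero {q : ℕ} [NeZero q] (d : ℕ) (β B b : ℝ) :
    BP d β B (biasVec q b) 0
      = Real.exp B * (1 + (Real.exp β - 1) * ((1 + ((q : ℝ) - 1) * b) / q)) ^ (d - 1)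
        / (Real.exp B * (1 + (Real.exp β - 1) * ((1 + ((q : ℝ) - 1) * b) / q)) ^ (d - 1)
          + ((q : ℝ) - 1) * (1 + (Real.exp β - 1) * ((1 - b) / q)) ^ (d - 1)) := by
  have hden : ∑ r : Fin q, psiBar B r * (1 + (Real.exp β - 1) * biasVec q b r) ^ (d - 1)
      = Real.exp B * (1 + (Real.exp β - 1) * ((1 + ((q : ℝ) - 1) * b) / q)) ^ (d - 1)
          + ((q : ℝ) - 1) * (1 + (Real.exp β - 1) * ((1 - b) / q)) ^ (d - 1) := by
    rw [← Finset.add_sum_erase _ _ (Finset.mem_univ (0 : Fin q))]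
    have h1 : ∀ r ∈ Finset.univ.erase (0 : Fin q),
        psiBar B r * (1 + (Real.exp β - 1) * biasVec q b r) ^ (d - 1)
          = (1 + (Real.exp β - 1) * ((1 - b) / q)) ^ (d - 1) := by
      intro r hr
      simp [psiBar, biasVec, Finset.ne_of_mem_erase hr]
    rw [Finset.sum_congr rfl h1, Finset.sum_const, Finset.card_erase_of_mem (Finset.mem_univ _),
      Finset.card_univ, Fintype.card_fin, nsmul_eq_mul,
      Nat.cast_pred (Nat.pos_of_ne_zero (NeZero.ne q))]
    simp [psiBar, biasVec]
  simp only [BP, sum_psi_biasVec, hden]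
  simp [psiBar, biasVec]

/-- On `[0, 1]` the univariate recursion is monotone with values in `[0, 1]`. -/
theorem bp_mono {q : ℕ} [NeZero q] (d : ℕ) (hq : 2 ≤ q) {β B : ℝ} (hβ : 0 ≤ β) (hB : 0 ≤ B)
    {b c : ℝ} (hb : 0 ≤ b) (hbc : b ≤ c) (hc : c ≤ 1) :
    0 ≤ bp d q β B b ∧ bp d q β B b ≤ bp d q β B c ∧ bp d q β B c ≤ 1 := by
  have hq2 : (2 : ℝ) ≤ q := by exact_mod_cast hq
  have hq1 : (0 : ℝ) < (q : ℝ) - 1 := by linarith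
  have hq0 : (0 : ℝ) < q := by linarith
  have hE : 0 ≤ Real.exp β - 1 := by linarith [Real.one_le_exp hβ]
  have hF : 1 ≤ Real.exp B := Real.one_le_exp hB
  have hFp : 0 < Real.exp B := Real.exp_pos B
  have key : ∀ x : ℝ, 0 ≤ x → x ≤ 1 →
      1 ≤ 1 + (Real.exp β - 1) * ((1 - x) / q) ∧
      1 + (Real.exp β - 1) * ((1 - x) / q)
        ≤ 1 + (Real.exp β - 1) * ((1 + ((q : ℝ) - 1) * x) / q) := by
    intro x hx hx1
    constructor
    · have : 0 ≤ (1 - x) / (q : ℝ) := div_nonneg (by linarith) hq0.le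
      nlinarith [mul_nonneg hE this]
    · have : (1 - x) / (q : ℝ) ≤ (1 + ((q : ℝ) - 1) * x) / q := by
        apply div_le_div_of_nonneg_right _ hq0.le
        nlinarith [mul_nonneg hq0.le hx]
      linarith [mul_le_mul_of_nonneg_left this hE]
  obtain ⟨kb1, kb2⟩ := key b hb (hbc.trans hc)
  obtain ⟨kc1, kc2⟩ := key c (hb.trans hbc) hc
  have m1 : 1 + (Real.exp β - 1) * ((1 + ((q : ℝ) - 1) * b) / q)
      ≤ 1 + (Real.exp β - 1) * ((1 + ((q : ℝ) - 1) * c) / q) := by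
    gcongr
  have m2 : 1 + (Real.exp β - 1) * ((1 - c) / q) ≤ 1 + (Real.exp β - 1) * ((1 - b) / q) := by
    gcongr
  simp only [bp, BP_biasVec_zero]
  generalize 1 + (Real.exp β - 1) * ((1 + ((q : ℝ) - 1) * b) / q) = x1 at *
  generalize 1 + (Real.exp β - 1) * ((1 + ((q : ℝ) - 1) * c) / q) = y1 at *
  generalize 1 + (Real.exp β - 1) * ((1 - b) / q) = x2 at *
  generalize 1 + (Real.exp β - 1) * ((1 - c) / q) = y2 at *
  have hx2 : 0 < x2 ^ (d - 1) := pow_pos (by linarith) _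
  have hy2 : 0 < y2 ^ (d - 1) := pow_pos (by linarith) _
  have hx1 : 0 < x1 ^ (d - 1) := pow_pos (by linarith) _
  have hy1 : 0 < y1 ^ (d - 1) := pow_pos (by linarith) _
  have hx : x2 ^ (d - 1) ≤ x1 ^ (d - 1) := pow_le_pow_left₀ (by linarith) kb2 _
  have p1 : x1 ^ (d - 1) ≤ y1 ^ (d - 1) := pow_le_pow_left₀ (by linarith) m1 _
  have p2 : y2 ^ (d - 1) ≤ x2 ^ (d - 1) := pow_le_pow_left₀ (by linarith) m2 _
  generalize x1 ^ (d - 1) = X1 at *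
  generalize y1 ^ (d - 1) = Y1 at *
  generalize x2 ^ (d - 1) = X2 at *
  generalize y2 ^ (d - 1) = Y2 at *
  have dx : 0 < Real.exp B * X1 + ((q : ℝ) - 1) * X2 := by positivity
  have dy : 0 < Real.exp B * Y1 + ((q : ℝ) - 1) * Y2 := by positivity
  refine ⟨div_nonneg ?_ hq1.le, ?_, ?_⟩
  · have : X1 ≤ Real.exp B * X1 := by nlinarith
    rw [← mul_div_assoc, sub_nonneg, le_div_iff₀ dx]
    nlinarith [mul_le_mul_of_nonneg_left (hx.trans this) hq1.le]
  · have : Real.exp B * X1 / (Real.exp B * X1 + ((q : ℝ) - 1) * X2)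
        ≤ Real.exp B * Y1 / (Real.exp B * Y1 + ((q : ℝ) - 1) * Y2) := by
      rw [div_le_div_iff₀ dx dy]
      have h1 : X1 * Y2 ≤ Y1 * X2 := mul_le_mul p1 p2 hy2.le hy1.le
      nlinarith [mul_le_mul_of_nonneg_left h1 (mul_pos hFp hq1).le]
    gcongr
  · rw [div_le_one hq1]
    have : Real.exp B * Y1 / (Real.exp B * Y1 + ((q : ℝ) - 1) * Y2) ≤ 1 := by
      rw [div_le_one dy]
      nlinarith [mul_pos hq1 hy2]
    nlinarith

theorem bp_iterate_mem {q : ℕ} [NeZero q] (d : ℕ) (hq : 2 ≤ q) {β B : ℝ} (hβ : 0 ≤ β)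
    (hB : 0 ≤ B) {b : ℝ} (hb : 0 ≤ b) (hb1 : b ≤ 1) (t : ℕ) :
    0 ≤ (bp d q β B)^[t] b ∧ (bp d q β B)^[t] b ≤ 1 := by
  induction t with
  | zero => exact ⟨hb, hb1⟩
  | succ t ih =>
    rw [Function.iterate_succ_apply']
    have h := bp_mono d hq hβ hB ih.1 le_rfl ih.2
    exact ⟨h.1, h.2.2⟩

/-- The iterates started from `0` converge, so `b^f` is their limit. -/
theorem tendsto_biasF {q : ℕ} [NeZero q] (d : ℕ) (hq : 2 ≤ q) {β B : ℝ} (hβ : 0 ≤ β)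
    (hB : 0 ≤ B) :
    Tendsto (fun t : ℕ => (bp d q β B)^[t] 0) atTop (𝓝 (biasF d q β B)) := by
  have hmem := bp_iterate_mem d hq hβ hB le_rfl zero_le_one
  apply tendsto_nhds_limUnder
  have hmono : Monotone (fun t : ℕ => (bp d q β B)^[t] 0) := by
    apply monotone_nat_of_le_succ
    intro t
    induction t with
    | zero => exact (hmem 1).1
    | succ t ih =>
      have h := (bp_mono d hq hβ hB (hmem t).1 ih (hmem (t + 1)).2).2.1
      simpa only [← Function.iterate_succ_apply' (bp d q β B)] using h
  exact ⟨_, tendsto_atTop_ciSup hmono ⟨1, by rintro _ ⟨t, rfl⟩; exact (hmem t).2⟩⟩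

/-- The iterates started from `1` converge, so `b^m` is their limit. -/
theorem tendsto_biasM {q : ℕ} [NeZero q] (d : ℕ) (hq : 2 ≤ q) {β B : ℝ} (hβ : 0 ≤ β)
    (hB : 0 ≤ B) :
    Tendsto (fun t : ℕ => (bp d q β B)^[t] 1) atTop (𝓝 (biasM d q β B)) := by
  have hmem := bp_iterate_mem d hq hβ hB zero_le_one le_rfl
  apply tendsto_nhds_limUnder
  have hanti : Antitone (fun t : ℕ => (bp d q β B)^[t] 1) := by
    apply antitone_nat_of_succ_le
    intro t
    induction t with
    | zero => exact (hmem 1).2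
    | succ t ih =>
      have h := (bp_mono d hq hβ hB (hmem (t + 1)).1 ih (hmem t).2).2.1
      simpa only [← Function.iterate_succ_apply' (bp d q β B)] using h
  exact ⟨_, tendsto_atTop_ciInf hanti ⟨0, by rintro _ ⟨t, rfl⟩; exact (hmem t).1⟩⟩

end PottsTree

end

/-!
Around a vertex `v` whose ball of radius `t` is a tree, let `S_k` be the sphere of radius `k`, and
let `H_k` be the graph without the vertices at distance less than `k` from `v`. The claim concerns
the spins of `S_1` in the Potts model on `H_1`. They are approximated by a mixture of product
measures at a depth `r` much smaller than `t`, and this approximation is carried from `S_r` to `S_1`.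

At depth `r` the mixture comes from the random cluster expansion of the Potts weight: each edge factor
is `1 + (e^β - 1) 1{σ_i = σ_j}`, so given the set of open bonds the spins are constant on clusters and
independent over clusters, and a cluster with `n` vertices has weights `(e^{Bn}, 1, …, 1)`, hence some
bias in `[0, 1]`. If every cluster met `S_r` at most once, this would be a mixture of product measures.
A cluster that meets `S_r` twice has to leave the ball, and so has at least `t - r` vertices
(`IsTreeLevel.le_card_cluster`). Its spin is then the distinguished one up to a probability of order
`e^{-B(t-r)}`, and a deterministic spin is again of product form
(`exists_product_of_clusters`, `approxMixture_of_clusters`). This is where `B > 0` enters.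

Each vertex of `S_k` has `d - 1` children in `S_{k+1}`, and summing out the children turns a product
measure with biases in `[x, y]` into one with biases in `[bp x, bp y]`, up to a factor that changes the
weight of the component in the mixture (`exists_bias_of_children`,
`IsTreeLevel.exists_product_of_layer`). So the biases at `S_1` lie between the iterates of `bp` at `0`
and at `1`, which are close to `b^f` and `b^m` when `r` is large. The `ℓ¹` error is multiplied by at
most `amplification d q β B r` on the way (`IsTreeLevel.approxMixture_one`), which does not depend on
`t`; hence `r = r(t)` can tend to infinity so slowly that the total error still vanishes
(`exists_slow_depth`). Vertices without a tree ball contribute at most their fraction `ζ_t(G)`.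

Configurations are functions on all of `V` throughout; the spins of removed vertices are free.
-/

noncomputable section

namespace PottsTree

/-! ### Levels in a tree-like neighbourhood -/

section Levels

variable {V : Type*}

theorem regularTree_isAcyclic (d : ℕ) : (regularTree d).IsAcyclic := by
  have key : ∀ (x y : TreeVertex d) (a : Fin d), y.1 = a :: x.1 →
      ¬ ((regularTree d).deleteEdges {s(x, y)}).Reachable y x := by
    intro x y a hy ⟨p⟩
    -- The words ending in `y` form a union of components once the edge below `y` is removed.
    have inv : ∀ u w, ((regularTree d).deleteEdges {s(x, y)}).Walk u w → y.1 <:+ u.1 →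
        y.1 <:+ w.1 := by
      intro u w p
      induction p with
      | nil => exact id
      | @cons u v w h _ ih =>
        intro hu
        apply ih
        rw [SimpleGraph.deleteEdges_adj] at h
        obtain ⟨⟨b, hb⟩ | ⟨b, hb⟩, hne⟩ := h
        · rw [hb]
          exact hu.trans (List.suffix_cons _ _)
        · rw [hb, List.suffix_cons_iff] at hu
          rcases hu with hu | hu
          · exfalso
            have h1 : u = y := Subtype.ext (hb.trans hu.symm)
            have h2 : v = x := by
              apply Subtype.ext
              rw [hy] at hu
              exact (List.cons.inj hu).2.symm
            apply hne
            rw [h1, h2]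
            exact Sym2.eq_swap
          · exact hu
    have := (inv _ _ p List.suffix_rfl).length_le
    rw [hy] at this
    simp at this
  rw [SimpleGraph.isAcyclic_iff_forall_adj_isBridge]
  rintro x y (⟨a, h⟩ | ⟨a, h⟩)
  · rw [SimpleGraph.isBridge_iff]
    exact fun hr => key x y a h hr.symm
  · rw [SimpleGraph.isBridge_iff]
    intro hr
    rw [Sym2.eq_swap] at hr
    exact key y x a h hr

/-- `lev` behaves up to level `t` like the distance to `v` in a graph whose ball of radius `t`
around `v` is a tree: levels change by at most one along edges, edges of the ball join different
levels, and `par w` is the only neighbour of `w` on a lower level. -/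
structure IsTreeLevel (G : SimpleGraph V) (t : ℕ) (v : V) (lev : V → ℕ) (par : V → V) : Prop where
  eq_zero_iff : ∀ w, lev w = 0 ↔ w = v
  le_add_one : ∀ u w, G.Adj u w → lev w ≤ lev u + 1
  ne_of_adj : ∀ u w, G.Adj u w → lev u ≤ t → lev u ≠ lev w
  adj_par : ∀ w, 1 ≤ lev w → lev w ≤ t → G.Adj w (par w)
  lev_par : ∀ w, 1 ≤ lev w → lev w ≤ t → lev (par w) + 1 = lev w
  eq_par : ∀ w p, lev w ≤ t → G.Adj w p → lev p < lev w → p = par w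

theorem ballGraph_reachable_and_dist (G : SimpleGraph V) (t : ℕ) (v : V)
    (hv : G.edist v v ≤ t) (w : V) (hw : G.edist v w ≤ t) :
    (ballGraph G t v).Reachable ⟨v, hv⟩ ⟨w, hw⟩ ∧
      ((ballGraph G t v).dist ⟨v, hv⟩ ⟨w, hw⟩ : ℕ∞) = G.edist v w := by
  have htop : G.edist v w ≠ ⊤ := ne_top_of_le_ne_top (ENat.natCast_ne_top t) hw
  obtain ⟨p, hp⟩ := SimpleGraph.exists_walk_of_edist_ne_top htop
  have hsupp : ∀ x ∈ p.support, x ∈ {w : V | G.edist v w ≤ (t : ℕ∞)} := by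
    classical
    intro x hx
    have h1 := SimpleGraph.edist_le (p.takeUntil x hx)
    have h2 : ((p.takeUntil x hx).length : ℕ∞) ≤ p.length := by
      exact_mod_cast p.length_takeUntil_le_length hx
    exact h1.trans (h2.trans (hp ▸ hw))
  let p' := p.induce _ hsupp
  have hp' : p'.length = p.length := by
    have := congrArg SimpleGraph.Walk.length (p.map_induce hsupp)
    rwa [SimpleGraph.Walk.length_map] at this
  refine ⟨⟨p'⟩, le_antisymm ?_ ?_⟩
  · rw [← hp, ← hp']
    exact_mod_cast SimpleGraph.dist_le p'
  · obtain ⟨r, hr⟩ := SimpleGraph.Reachable.exists_walk_length_eq_dist ⟨p'⟩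
    have := SimpleGraph.edist_le (r.map (SimpleGraph.Embedding.induce _).toHom)
    rw [SimpleGraph.Walk.length_map, hr] at this
    exact this

/-- The isomorphism in `IsTreeBall` need not send `v` to the root, so only the absence of cycles is
used. The distances to `v` serve as levels, cut off at `t + 1`. -/
theorem IsTreeBall.exists_level {d t : ℕ} {G : SimpleGraph V} {v : V}
    (h : IsTreeBall d G t v) : ∃ lev par, IsTreeLevel G t v lev par := by
  obtain ⟨φ⟩ := h
  have hB : (ballGraph G t v).IsAcyclic := by
    rw [φ.isAcyclic_iff]
    exact (regularTree_isAcyclic d).induce _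
  have hv : G.edist v v ≤ t := by simp
  set B := ballGraph G t v
  -- Vertices at infinite distance, and all others outside the ball, get the level `t + 1`.
  have hlev : ∀ w, ∃ n : ℕ, (n : ℕ∞) = min (G.edist v w) (t + 1 : ℕ) := fun w =>
    ENat.ne_top_iff_exists.1 (ne_top_of_le_ne_top (ENat.natCast_ne_top _) (min_le_right _ _))
  choose lev hlev using hlev
  have hmem : ∀ w, lev w ≤ t → ∃ hw : G.edist v w ≤ t, B.dist ⟨v, hv⟩ ⟨w, hw⟩ = lev w ∧
      B.Reachable ⟨v, hv⟩ ⟨w, hw⟩ := by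
    intro w hw
    have h1 : G.edist v w = lev w := by
      rcases min_choice (G.edist v w) ((t + 1 : ℕ) : ℕ∞) with h | h
      · rw [hlev, h]
      · have := hlev w
        rw [h] at this
        have : lev w = t + 1 := by exact_mod_cast this
        omega
    have h2 : G.edist v w ≤ t := by rw [h1]; exact_mod_cast hw
    obtain ⟨h3, h4⟩ := ballGraph_reachable_and_dist G t v hv w h2
    refine ⟨h2, ?_, h3⟩
    rw [h1] at h4
    exact_mod_cast h4
  have hstep : ∀ u w, G.Adj u w → lev w ≤ lev u + 1 := by
    intro u w huw
    have h1 : G.edist v w ≤ G.edist v u + 1 := by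
      rw [← SimpleGraph.edist_eq_one_iff_adj.2 huw]
      exact SimpleGraph.edist_triangle
    have h2 : (lev w : ℕ∞) ≤ (lev u : ℕ∞) + 1 := by
      rw [hlev, hlev]
      rcases min_choice (G.edist v u) ((t + 1 : ℕ) : ℕ∞) with h | h
      · rw [h]
        exact (min_le_left _ _).trans h1
      · rw [h]
        exact (min_le_right _ _).trans le_self_add
    exact_mod_cast h2
  have hpar0 : ∀ w, 1 ≤ lev w → lev w ≤ t → ∃! p, G.Adj w p ∧ lev p + 1 = lev w := by
    intro w hw1 hwt
    obtain ⟨hw, hd, hr⟩ := hmem w hwt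
    have hpar : ∀ p (hp : G.Adj w p ∧ lev p + 1 = lev w), ∃ (hpb : G.edist v p ≤ t)
        (P : B.Walk ⟨v, hv⟩ ⟨w, hw⟩), P.IsPath ∧ P.penultimate = ⟨p, hpb⟩ := by
      rintro p ⟨hadj, hp⟩
      obtain ⟨hpb, hpd, hpr⟩ := hmem p (by omega)
      obtain ⟨P, hP⟩ := hpr.exists_walk_length_eq_dist
      have hadj' : B.Adj ⟨p, hpb⟩ ⟨w, hw⟩ := hadj.symm
      refine ⟨hpb, P.concat hadj', ?_, P.penultimate_concat hadj'⟩
      apply SimpleGraph.Walk.isPath_of_length_eq_dist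
      rw [SimpleGraph.Walk.length_concat, hP, hpd, hd, hp]
    obtain ⟨P, hP⟩ := hr.exists_walk_length_eq_dist
    have hlen : 0 < P.length := by rw [hP, hd]; omega
    have hnn : ¬ P.Nil := by
      rw [← SimpleGraph.Walk.length_eq_zero_iff]; omega
    have hadj : B.Adj P.penultimate ⟨w, hw⟩ := P.adj_penultimate hnn
    have hadjG : G.Adj P.penultimate.1 w := hadj
    have hle := hstep _ _ hadjG
    have hpl : lev P.penultimate.1 + 1 ≤ lev w := by
      have h1 : B.dist ⟨v, hv⟩ P.penultimate ≤ P.dropLast.length := SimpleGraph.dist_le _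
      have h2 : P.dropLast.length + 1 = P.length := by simp; omega
      have h3 := (ballGraph_reachable_and_dist G t v hv P.penultimate.1 P.penultimate.2).2
      have h4 : (lev P.penultimate.1 : ℕ∞) ≤ B.dist ⟨v, hv⟩ P.penultimate := by
        rw [hlev]
        exact (min_le_left _ _).trans h3.ge
      have h5 : lev P.penultimate.1 ≤ B.dist ⟨v, hv⟩ P.penultimate := by exact_mod_cast h4
      omega
    refine ⟨P.penultimate.1, ⟨hadjG.symm, by omega⟩, ?_⟩
    intro p hp
    obtain ⟨_, Q, hQ, hQp⟩ := hpar p hp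
    obtain ⟨_, R, hR, hRp⟩ := hpar P.penultimate.1 ⟨hadjG.symm, by omega⟩
    have : Q = R := congrArg Subtype.val ((hB.subsingleton_path _ _).elim ⟨Q, hQ⟩ ⟨R, hR⟩)
    rw [this] at hQp
    exact congrArg Subtype.val (hQp.symm.trans hRp)
  have hne : ∀ u w, G.Adj u w → lev u ≤ t → lev u ≠ lev w := by
    intro u w huw hu heq
    obtain ⟨hu1, hu2, hu3⟩ := hmem u hu
    obtain ⟨hw1, hw2, -⟩ := hmem w (heq ▸ hu)
    have hadj : B.Adj ⟨u, hu1⟩ ⟨w, hw1⟩ := huw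
    exact hB.dist_ne_of_adj hadj hu3 (by rw [hu2, hw2, heq])
  have hpar : ∀ w, ∃ p, 1 ≤ lev w → lev w ≤ t →
      (G.Adj w p ∧ lev p + 1 = lev w) ∧ ∀ p', G.Adj w p' ∧ lev p' + 1 = lev w → p' = p := by
    intro w
    by_cases hw : 1 ≤ lev w ∧ lev w ≤ t
    · obtain ⟨p, hp, hp'⟩ := hpar0 w hw.1 hw.2
      exact ⟨p, fun _ _ => ⟨hp, hp'⟩⟩
    · exact ⟨w, fun h1 h2 => absurd ⟨h1, h2⟩ hw⟩
  choose par hpar using hpar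
  refine ⟨lev, par, ⟨?_, hstep, hne, fun w h1 h2 => (hpar w h1 h2).1.1,
    fun w h1 h2 => (hpar w h1 h2).1.2, fun w p h1 h2 h3 => (hpar w (by omega) h1).2 p
      ⟨h2, by have := hstep _ _ h2.symm; omega⟩⟩⟩
  · intro w
    have : lev w = 0 ↔ G.edist v w = 0 := by
      rw [← Nat.cast_eq_zero (R := ℕ∞), hlev, ← nonpos_iff_eq_zero, min_le_iff]
      simp
    rw [this, SimpleGraph.edist_eq_zero_iff, eq_comm]

namespace IsTreeLevel

variable {G : SimpleGraph V} {t : ℕ} {v : V} {lev : V → ℕ} {par : V → V}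

theorem adj_root_iff (h : IsTreeLevel G t v lev par) (ht : 1 ≤ t) (w : V) :
    G.Adj v w ↔ lev w = 1 := by
  have h0 : lev v = 0 := (h.eq_zero_iff v).2 rfl
  constructor
  · intro hw
    have h1 := h.le_add_one _ _ hw
    have h2 := h.ne_of_adj _ _ hw (by omega)
    omega
  · intro hw
    have h1 := h.lev_par w (by omega) (by omega)
    have h2 := h.adj_par w (by omega) (by omega)
    rw [(h.eq_zero_iff (par w)).1 (by omega)] at h2
    exact h2.symm

theorem exists_reachable_lev_eq (h : IsTreeLevel G t v lev par) {H : SimpleGraph V} (hHG : H ≤ G)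
    {u w : V} (p : H.Walk u w) {n : ℕ} (hu : lev u ≤ n) (hw : n ≤ lev w) :
    ∃ x, H.Reachable u x ∧ lev x = n := by
  induction p with
  | nil => exact ⟨_, .rfl, le_antisymm hu hw⟩
  | @cons u x w hux p ih =>
    rcases hu.eq_or_lt with hu | hu
    · exact ⟨u, .rfl, hu⟩
    · obtain ⟨y, hy, hyn⟩ := ih ((h.le_add_one _ _ (hHG hux)).trans hu) hw
      exact ⟨y, hux.reachable.trans hy, hyn⟩

/-- Along a walk that stays between the levels `r` and `t`, the ancestor on level `r` is
constant. -/
theorem iterate_par_eq_of_walk (h : IsTreeLevel G t v lev par) {H : SimpleGraph V} (hHG : H ≤ G)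
    {r : ℕ} (hr : ∀ a b, H.Adj a b → r ≤ lev a) {u w : V} (p : H.Walk u w)
    (ht : ∀ x, H.Reachable u x → lev x ≤ t) :
    par^[lev u - r] u = par^[lev w - r] w := by
  have key : ∀ a b, H.Adj a b → lev b ≤ t → lev a < lev b →
      par^[lev a - r] a = par^[lev b - r] b := by
    intro a b hab hb hlt
    have h1 := h.le_add_one _ _ (hHG hab)
    have h2 : lev b - r = (lev a - r) + 1 := by have := hr _ _ hab; omega
    rw [h2, Function.iterate_succ_apply, ← h.eq_par b a hb (hHG hab).symm hlt]
  induction p with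
  | nil => rfl
  | @cons u x w hux p ih =>
    rw [← ih fun y hy => ht y (hux.reachable.trans hy)]
    have hu := ht u .rfl
    have hx := ht x hux.reachable
    rcases lt_or_gt_of_ne (h.ne_of_adj _ _ (hHG hux) hu) with hlt | hlt
    · exact key _ _ hux hx hlt
    · exact (key _ _ hux.symm hu hlt).symm

/-- A cluster above level `r` containing two vertices of level `r` leaves the ball of radius `t`,
and so it meets all levels in between. -/
theorem le_card_cluster [Fintype V] [DecidableEq V] (h : IsTreeLevel G t v lev par)
    {H : SimpleGraph V} (hHG : H ≤ G) {r : ℕ} (hr : ∀ a b, H.Adj a b → r ≤ lev a) {u w : V}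
    (hu : lev u = r) (hw : lev w = r) (huw : u ≠ w) (hreach : H.Reachable u w)
    (C : Finset V) (hC : ∀ x, H.Reachable u x → r ≤ lev x → x ∈ C) : t - r ≤ C.card := by
  obtain ⟨x, hx, hxt⟩ : ∃ x, H.Reachable u x ∧ t < lev x := by
    by_contra! hcon
    obtain ⟨p⟩ := hreach
    have := h.iterate_par_eq_of_walk hHG hr p hcon
    rw [hu, hw] at this
    exact huw (by simpa using this)
  obtain ⟨p⟩ := hx
  have hsub : Finset.Ico r t ⊆ C.image lev := by
    intro n hn
    rw [Finset.mem_Ico] at hn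
    obtain ⟨y, hy, hyn⟩ := h.exists_reachable_lev_eq hHG p (hu.trans_le hn.1) (hn.2.le.trans hxt.le)
    exact Finset.mem_image.2 ⟨y, hC y hy (hyn ▸ hn.1), hyn⟩
  calc t - r = (Finset.Ico r t).card := by simp
    _ ≤ (C.image lev).card := Finset.card_le_card hsub
    _ ≤ C.card := Finset.card_image_le

theorem neighborFinset_eq [Fintype V] [DecidableEq V] [G.LocallyFinite]
    (h : IsTreeLevel G t v lev par) {u : V} (hu : 1 ≤ lev u) (hut : lev u + 1 ≤ t) :
    G.neighborFinset u
      = insert (par u) (({c | lev c = lev u + 1} : Finset V).filter (par · = u)) := by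
  ext w
  simp only [SimpleGraph.mem_neighborFinset, Finset.mem_insert, Finset.mem_filter,
    Finset.mem_univ, true_and]
  constructor
  · intro hw
    rcases lt_or_gt_of_ne (h.ne_of_adj _ _ hw (by omega)) with hlt | hlt
    · have := h.le_add_one _ _ hw
      exact .inr ⟨by omega, (h.eq_par w u (by omega) hw.symm hlt).symm⟩
    · exact .inl (h.eq_par u w (by omega) hw hlt)
  · rintro (rfl | ⟨hw, rfl⟩)
    · exact h.adj_par u hu (by omega)
    · exact (h.adj_par w (by omega) (by omega)).symm

theorem card_children [Fintype V] [DecidableEq V] [G.LocallyFinite] {d : ℕ}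
    (h : IsTreeLevel G t v lev par) (hG : G.IsRegularOfDegree d) {u : V} (hu : 1 ≤ lev u)
    (hut : lev u + 1 ≤ t) :
    (({c | lev c = lev u + 1} : Finset V).filter (par · = u)).card = d - 1 := by
  have h1 := hG.degree_eq u
  rw [← SimpleGraph.card_neighborFinset_eq_degree, h.neighborFinset_eq hu hut,
    Finset.card_insert_of_notMem] at h1
  · omega
  · have := h.lev_par u hu (by omega)
    simp only [Finset.mem_filter, Finset.mem_univ, true_and, not_and]
    intro h2
    omega

theorem card_level_le [Fintype V] [DecidableEq V] [G.LocallyFinite] {d : ℕ}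
    (h : IsTreeLevel G t v lev par) (hG : G.IsRegularOfDegree d) {k : ℕ} (hk : k ≤ t) :
    ({c | lev c = k} : Finset V).card ≤ d ^ k := by
  induction k with
  | zero =>
    have : ({c | lev c = 0} : Finset V) = {v} := by ext w; simp [h.eq_zero_iff]
    simp [this]
  | succ k ih =>
    have hmap : ∀ c ∈ ({c | lev c = k + 1} : Finset V), par c ∈ ({c | lev c = k} : Finset V) := by
      intro c hc
      simp only [Finset.mem_filter, Finset.mem_univ, true_and] at hc ⊢
      have := h.lev_par c (by omega) (by omega)
      omega
    have hfib : ∀ u ∈ ({c | lev c = k} : Finset V),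
        (({c | lev c = k + 1} : Finset V).filter (par · = u)).card ≤ d := by
      intro u _
      rw [← hG.degree_eq u, ← SimpleGraph.card_neighborFinset_eq_degree]
      apply Finset.card_le_card
      intro c hc
      simp only [Finset.mem_filter, Finset.mem_univ, true_and] at hc
      rw [SimpleGraph.mem_neighborFinset, ← hc.2]
      exact (h.adj_par c (by omega) (by omega)).symm
    calc ({c | lev c = k + 1} : Finset V).card
        ≤ d * ({c | lev c = k} : Finset V).card :=
          Finset.card_le_mul_card_image_of_maps_to hmap d hfib
      _ ≤ d * d ^ k := Nat.mul_le_mul_left d (ih (by omega))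
      _ = d ^ (k + 1) := by ring

end IsTreeLevel

end Levels

/-! ### Biases -/

section Bias

variable {q : ℕ} [NeZero q]

theorem sum_biasVec (b : ℝ) : ∑ s, biasVec q b s = 1 := by
  have h := sum_psi_biasVec (q := q) 0 b 0
  simpa [psi] using h

theorem biasVec_nonneg {b : ℝ} (h0 : 0 ≤ b) (h1 : b ≤ 1) (s : Fin q) : 0 ≤ biasVec q b s := by
  have hq : (1 : ℝ) ≤ q := by exact_mod_cast NeZero.one_le
  have h2 : 0 ≤ ((q : ℝ) - 1) * b := mul_nonneg (by linarith) h0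
  unfold biasVec
  split_ifs <;> apply div_nonneg <;> linarith

theorem biasVec_zero (s : Fin q) : biasVec q 0 s = 1 / q := by
  simp [biasVec]

theorem biasVec_one (s : Fin q) : biasVec q 1 s = if s = 0 then 1 else 0 := by
  have hq : (q : ℝ) ≠ 0 := Nat.cast_ne_zero.2 (NeZero.ne q)
  unfold biasVec
  split_ifs
  · field_simp
    ring
  · simp

/-- The bias of the probability vector proportional to `(x, y, …, y)`. -/
def biasOf (q : ℕ) (x y : ℝ) : ℝ := (x - y) / (x + ((q : ℝ) - 1) * y)

theorem ite_eq_mul_biasVec {x y : ℝ} (h : x + ((q : ℝ) - 1) * y ≠ 0) (s : Fin q) :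
    (if s = 0 then x else y) = (x + ((q : ℝ) - 1) * y) * biasVec q (biasOf q x y) s := by
  have hq : (q : ℝ) ≠ 0 := Nat.cast_ne_zero.2 (NeZero.ne q)
  unfold biasVec biasOf
  obtain ⟨D, rfl⟩ : ∃ D, x = D - ((q : ℝ) - 1) * y := ⟨x + ((q : ℝ) - 1) * y, by ring⟩
  rw [sub_add_cancel] at h ⊢
  split_ifs <;> field_simp <;> ring

theorem biasOf_le_biasOf {x y x' y' : ℝ} (hx : 0 < x) (hy : 0 < y) (hx' : 0 < x') (hy' : 0 < y')
    (h : x * y' ≤ x' * y) : biasOf q x y ≤ biasOf q x' y' := by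
  have hq : (0 : ℝ) ≤ (q : ℝ) - 1 := by
    have : (1 : ℝ) ≤ q := by exact_mod_cast NeZero.one_le
    linarith
  have h1 : 0 < x + ((q : ℝ) - 1) * y := by positivity
  have h2 : 0 < x' + ((q : ℝ) - 1) * y' := by positivity
  unfold biasOf
  rw [div_le_div_iff₀ h1 h2]
  nlinarith [mul_le_mul_of_nonneg_left h hq]

theorem biasOf_nonneg {x y : ℝ} (hy : 0 < y) (h : y ≤ x) : 0 ≤ biasOf q x y := by
  have hq : (0 : ℝ) ≤ (q : ℝ) - 1 := by
    have : (1 : ℝ) ≤ q := by exact_mod_cast NeZero.one_le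
    linarith
  have hx : 0 < x := hy.trans_le h
  exact div_nonneg (by linarith) (by positivity)

theorem biasOf_le_one {x y : ℝ} (hx : 0 < x) (hy : 0 < y) : biasOf q x y ≤ 1 := by
  have hq : (0 : ℝ) ≤ (q : ℝ) - 1 := by
    have : (1 : ℝ) ≤ q := by exact_mod_cast NeZero.one_le
    linarith
  have h1 : 0 < x + ((q : ℝ) - 1) * y := by positivity
  unfold biasOf
  rw [div_le_one h1]
  nlinarith [mul_nonneg hq hy.le]

theorem psiBar_eq_mul_biasVec (B : ℝ) (s : Fin q) :
    psiBar B s = (Real.exp B + ((q : ℝ) - 1)) * biasVec q (biasOf q (Real.exp B) 1) s := by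
  have hq : (1 : ℝ) ≤ q := by exact_mod_cast NeZero.one_le
  have h := ite_eq_mul_biasVec (q := q) (x := Real.exp B) (y := 1)
    (by have := Real.exp_pos B; intro h0; linarith) s
  rw [mul_one] at h
  rw [← h]
  by_cases hs : s = 0 <;> simp [psiBar, hs]

theorem bp_eq_biasOf (d : ℕ) (hq : 2 ≤ q) {β : ℝ} (hβ : 0 ≤ β) (B : ℝ) {b : ℝ} (hb : 0 ≤ b)
    (hb1 : b ≤ 1) :
    bp d q β B b = biasOf q
      (Real.exp B * (1 + (Real.exp β - 1) * ((1 + ((q : ℝ) - 1) * b) / q)) ^ (d - 1))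
      ((1 + (Real.exp β - 1) * ((1 - b) / q)) ^ (d - 1)) := by
  have hq2 : (2 : ℝ) ≤ q := by exact_mod_cast hq
  have hq1 : (0 : ℝ) < (q : ℝ) - 1 := by linarith
  have hE : 0 ≤ Real.exp β - 1 := by linarith [Real.one_le_exp hβ]
  have h0 : 0 < 1 + (Real.exp β - 1) * ((1 + ((q : ℝ) - 1) * b) / q) := by positivity
  have h1 : 0 < 1 + (Real.exp β - 1) * ((1 - b) / q) := by
    have : 0 ≤ 1 - b := by linarith
    positivity
  unfold bp biasOf
  rw [BP_biasVec_zero]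
  generalize (1 + (Real.exp β - 1) * ((1 + ((q : ℝ) - 1) * b) / q)) = X at *
  generalize 1 + (Real.exp β - 1) * ((1 - b) / q) = Y at *
  have hX : 0 < Real.exp B * X ^ (d - 1) := by positivity
  have hY : 0 < Y ^ (d - 1) := by positivity
  generalize Real.exp B * X ^ (d - 1) = X' at *
  generalize Y ^ (d - 1) = Y' at *
  have : X' + ((q : ℝ) - 1) * Y' ≠ 0 := by positivity
  field_simp
  ring

/-- Belief propagation with `d - 1` different incoming biases: the outgoing message has a bias, and
by monotonicity this bias is controlled by the univariate recursion. -/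
theorem exists_bias_of_children {ι : Type*} (d : ℕ) (hq : 2 ≤ q) {β B : ℝ} (hβ : 0 ≤ β)
    {lo hi : ℝ} (hlo : 0 ≤ lo) (hhi : hi ≤ 1) (T : Finset ι) (hT : T.card = d - 1)
    (b : ι → ℝ) (hb : ∀ c ∈ T, lo ≤ b c ∧ b c ≤ hi) (hlohi : lo ≤ hi) :
    ∃ z b' : ℝ, 0 < z ∧ bp d q β B lo ≤ b' ∧ b' ≤ bp d q β B hi ∧
      ∀ s : Fin q, psiBar B s * ∏ c ∈ T, ∑ s', psi β s s' * biasVec q (b c) s'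
        = z * biasVec q b' s := by
  have hq2 : (2 : ℝ) ≤ q := by exact_mod_cast hq
  have hq1 : (0 : ℝ) < (q : ℝ) - 1 := by linarith
  have hE : 0 ≤ Real.exp β - 1 := by linarith [Real.one_le_exp hβ]
  rw [bp_eq_biasOf d hq hβ B hlo (hlohi.trans hhi), bp_eq_biasOf d hq hβ B (hlo.trans hlohi) hhi]
  set L₀ : ℝ → ℝ := fun b => 1 + (Real.exp β - 1) * ((1 + ((q : ℝ) - 1) * b) / q) with hL₀
  set L₁ : ℝ → ℝ := fun b => 1 + (Real.exp β - 1) * ((1 - b) / q) with hL₁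
  have m₀ : ∀ x y, x ≤ y → L₀ x ≤ L₀ y := fun x y hxy => by simp only [hL₀]; gcongr
  have m₁ : ∀ x y, x ≤ y → L₁ y ≤ L₁ x := fun x y hxy => by simp only [hL₁]; gcongr
  have p₀ : ∀ x, 0 ≤ x → 0 < L₀ x := fun x hx => by simp only [hL₀]; positivity
  have p₁ : ∀ x, x ≤ 1 → 0 < L₁ x := fun x hx => by
    have : 0 ≤ 1 - x := by linarith
    simp only [hL₁]; positivity
  have hb0 : ∀ c ∈ T, 0 ≤ b c := fun c hc => hlo.trans (hb c hc).1
  have hb1 : ∀ c ∈ T, b c ≤ 1 := fun c hc => (hb c hc).2.trans hhi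
  have hP₀ : 0 < ∏ c ∈ T, L₀ (b c) := Finset.prod_pos fun c hc => p₀ _ (hb0 c hc)
  have hP₁ : 0 < ∏ c ∈ T, L₁ (b c) := Finset.prod_pos fun c hc => p₁ _ (hb1 c hc)
  have hX : 0 < Real.exp B * ∏ c ∈ T, L₀ (b c) := by positivity
  have hbounds : L₀ lo ^ (d - 1) ≤ ∏ c ∈ T, L₀ (b c) ∧ ∏ c ∈ T, L₀ (b c) ≤ L₀ hi ^ (d - 1) ∧
      L₁ hi ^ (d - 1) ≤ ∏ c ∈ T, L₁ (b c) ∧ ∏ c ∈ T, L₁ (b c) ≤ L₁ lo ^ (d - 1) := by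
    rw [← hT]
    simp only [← Finset.prod_const]
    exact ⟨Finset.prod_le_prod (fun _ _ => (p₀ lo hlo).le) fun c hc => m₀ _ _ (hb c hc).1,
      Finset.prod_le_prod (fun c hc => (p₀ _ (hb0 c hc)).le) fun c hc => m₀ _ _ (hb c hc).2,
      Finset.prod_le_prod (fun _ _ => (p₁ hi hhi).le) fun c hc => m₁ _ _ (hb c hc).2,
      Finset.prod_le_prod (fun c hc => (p₁ _ (hb1 c hc)).le) fun c hc => m₁ _ _ (hb c hc).1⟩
  obtain ⟨k1, k2, k3, k4⟩ := hbounds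
  have hlo0 := pow_pos (p₀ lo hlo) (d - 1)
  have hlo1 := pow_pos (p₁ lo (hlohi.trans hhi)) (d - 1)
  have hhi0 := pow_pos (p₀ hi (hlo.trans hlohi)) (d - 1)
  have hhi1 := pow_pos (p₁ hi hhi) (d - 1)
  refine ⟨Real.exp B * ∏ c ∈ T, L₀ (b c) + ((q : ℝ) - 1) * ∏ c ∈ T, L₁ (b c),
    biasOf q (Real.exp B * ∏ c ∈ T, L₀ (b c)) (∏ c ∈ T, L₁ (b c)), by positivity, ?_, ?_, ?_⟩
  · apply biasOf_le_biasOf (by positivity) hlo1 hX hP₁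
    exact mul_le_mul (mul_le_mul_of_nonneg_left k1 (Real.exp_pos B).le) k4 hP₁.le hX.le
  · apply biasOf_le_biasOf hX hP₁ (by positivity) hhi1
    exact mul_le_mul (mul_le_mul_of_nonneg_left k2 (Real.exp_pos B).le) k3 hhi1.le (by positivity)
  · intro s
    rw [← ite_eq_mul_biasVec (by positivity)]
    simp only [sum_psi_biasVec]
    by_cases hs : s = 0 <;> simp [psiBar, hs, biasVec, hL₀, hL₁]

end Bias

/-! ### Sums over spin configurations -/

section Sums

variable {V : Type*} [Fintype V] [DecidableEq V] {α : Type*} [Fintype α]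

theorem sum_sum_update (a : V) (H : (V → α) → ℝ) :
    ∑ σ, ∑ s, H (Function.update σ a s) = Fintype.card α * ∑ σ, H σ := by
  have hinv : Function.Involutive
      (fun x : (V → α) × α => (Function.update x.1 a x.2, x.1 a)) := by
    rintro ⟨σ, s⟩
    simp
  calc ∑ σ, ∑ s, H (Function.update σ a s)
      = ∑ x : (V → α) × α, H (Function.update x.1 a x.2) := by rw [Fintype.sum_prod_type]
    _ = ∑ x : (V → α) × α, H x.1 :=
        Fintype.sum_equiv hinv.toPerm _ _ fun _ => rfl
    _ = Fintype.card α * ∑ σ, H σ := by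
        rw [Fintype.sum_prod_type]
        simp [Finset.mul_sum]

/-- Integrating out the spins in `T`, which enter only through the factors `g`. -/
theorem sum_integrate_out [Nonempty α] (T : Finset V) (g : V → (V → α) → α → ℝ)
    (hg : ∀ c ∈ T, ∀ a ∈ T, ∀ σ s, g c (Function.update σ a s) = g c σ) (F : (V → α) → ℝ)
    (hF : ∀ a ∈ T, ∀ σ s, F (Function.update σ a s) = F σ) :
    ∑ σ, (∏ c ∈ T, g c σ (σ c)) * F σ
      = (1 / (Fintype.card α : ℝ)) ^ T.card * ∑ σ, (∏ c ∈ T, ∑ s, g c σ s) * F σ := by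
  have hα : (Fintype.card α : ℝ) ≠ 0 := Nat.cast_ne_zero.2 Fintype.card_ne_zero
  induction T using Finset.induction_on generalizing F with
  | empty => simp
  | insert a T ha ih =>
    have hgT : ∀ c ∈ insert a T, ∀ b ∈ T, ∀ σ s, g c (Function.update σ b s) = g c σ :=
      fun c hc b hb => hg c hc b (Finset.mem_insert_of_mem hb)
    have h1 := ih (fun c hc => hgT c (Finset.mem_insert_of_mem hc)) (fun σ => g a σ (σ a) * F σ) (by
      intro b hb σ s
      have hba : b ≠ a := fun h => ha (h ▸ hb)
      simp only [hgT a (Finset.mem_insert_self a T) b hb, hF b (Finset.mem_insert_of_mem hb),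
        Function.update_of_ne hba.symm])
    have h2 := sum_sum_update a fun σ => (∏ c ∈ T, ∑ s, g c σ s) * (g a σ (σ a) * F σ)
    have hprod : ∀ σ s, ∏ c ∈ T, ∑ r, g c (Function.update σ a s) r = ∏ c ∈ T, ∑ r, g c σ r :=
      fun σ s => Finset.prod_congr rfl fun c hc => by
        rw [hg c (Finset.mem_insert_of_mem hc) a (Finset.mem_insert_self a T)]
    simp only [hg a (Finset.mem_insert_self a T) a (Finset.mem_insert_self a T), hprod,
      hF a (Finset.mem_insert_self a T), Function.update_self] at h2
    have h3 : ∑ σ, (∏ c ∈ insert a T, g c σ (σ c)) * F σ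
        = ∑ σ, (∏ c ∈ T, g c σ (σ c)) * (g a σ (σ a) * F σ) := by
      refine Finset.sum_congr rfl fun σ _ => ?_
      rw [Finset.prod_insert ha]
      ring
    have h4 : ∑ σ, (∏ c ∈ insert a T, ∑ s, g c σ s) * F σ
        = ∑ σ, ∑ s, (∏ c ∈ T, ∑ s, g c σ s) * (g a σ s * F σ) := by
      refine Finset.sum_congr rfl fun σ _ => ?_
      rw [Finset.prod_insert ha, ← Finset.mul_sum, ← Finset.sum_mul]
      ring
    rw [h3, h1, h4, h2, Finset.card_insert_of_notMem ha, pow_succ]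
    field_simp

/-- The marginal of a product of probability vectors along an injection. -/
theorem sum_prod_mul_comp_injective [DecidableEq α] {C : Type*} [Fintype C] [DecidableEq C]
    {rep : C → V} (hrep : Function.Injective rep) (p : V → α → ℝ) (hp : ∀ u, ∑ s, p u s = 1)
    (F : (C → α) → ℝ) :
    ∑ σ : V → α, (∏ u, p u (σ u)) * F (σ ∘ rep) = ∑ c : C → α, (∏ x, p (rep x) (c x)) * F c := by
  have key : ∀ c : C → α, ∑ σ : V → α, (∏ u, p u (σ u)) * (if σ ∘ rep = c then 1 else 0)
      = ∏ x, p (rep x) (c x) := by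
    intro c
    have h1 : ∀ σ : V → α, (∏ u, p u (σ u)) * (if σ ∘ rep = c then 1 else 0)
        = ∏ u, (p u (σ u) * ∏ x with rep x = u, if σ u = c x then (1 : ℝ) else 0) := by
      intro σ
      rw [Finset.prod_mul_distrib]
      congr 1
      have h2 : ∀ u, (∏ x with rep x = u, if σ u = c x then (1 : ℝ) else 0)
          = ∏ x with rep x = u, if σ (rep x) = c x then (1 : ℝ) else 0 := by
        intro u
        refine Finset.prod_congr rfl fun x hx => ?_
        rw [(Finset.mem_filter.1 hx).2]
      simp only [h2]
      rw [Finset.prod_fiberwise, Finset.prod_ite_zero]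
      simp [funext_iff]
    simp only [h1]
    rw [← Fintype.prod_sum fun u s =>
      p u s * ∏ x with rep x = u, if s = c x then (1 : ℝ) else 0]
    symm
    apply Fintype.prod_of_injective rep hrep
    · intro u hu
      have : ({x | rep x = u} : Finset C) = ∅ := by
        ext x
        simp only [Finset.mem_filter, Finset.mem_univ, true_and, Finset.notMem_empty, iff_false]
        exact fun h => hu ⟨x, h⟩
      simp [this, hp]
    · intro x
      have : ({y | rep y = rep x} : Finset C) = {x} := by
        ext y
        simp [hrep.eq_iff]
      simp [this]
  have h1 : ∀ σ : V → α, F (σ ∘ rep) = ∑ c, (if σ ∘ rep = c then 1 else 0) * F c := by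
    intro σ
    simp
  simp only [h1, Finset.mul_sum]
  rw [Finset.sum_comm]
  refine Finset.sum_congr rfl fun c _ => ?_
  rw [← key c, Finset.sum_mul]
  exact Finset.sum_congr rfl fun σ _ => by ring

end Sums

/-! ### Independent spins on clusters -/

section Cluster

variable {q : ℕ} [NeZero q]

theorem psiBar_pos (B : ℝ) (s : Fin q) : 0 < psiBar B s := Real.exp_pos _

theorem one_le_psiBar {B : ℝ} (hB : 0 ≤ B) (s : Fin q) : 1 ≤ psiBar B s := by
  apply Real.one_le_exp
  split_ifs <;> simp [hB]

theorem psiBar_pow (B : ℝ) (s : Fin q) (n : ℕ) : psiBar B s ^ n = psiBar (B * n) s := by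
  unfold psiBar
  rw [← Real.exp_nat_mul]
  congr 1
  ring

/-- A single spin of a product measure with weights `psiBar (a x)` is rarely non-zero when `a x` is
large. -/
theorem sum_prod_psiBar_ne_zero_le {C : Type*} [Fintype C] [DecidableEq C] (a : C → ℝ) (x : C) :
    ∑ c : C → Fin q, (∏ y, psiBar (a y) (c y)) * (if c x ≠ 0 then 1 else 0)
      ≤ q * Real.exp (-a x) * ∑ c : C → Fin q, ∏ y, psiBar (a y) (c y) := by
  have h1 : ∀ c : C → Fin q, (∏ y, psiBar (a y) (c y)) * (if c x ≠ 0 then 1 else 0)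
      ≤ Real.exp (-a x) * ∑ s, ∏ y, psiBar (a y) (Function.update c x s y) := by
    intro c
    have h0 : ∀ s, 0 ≤ ∏ y, psiBar (a y) (Function.update c x s y) :=
      fun s => Finset.prod_nonneg fun y _ => (psiBar_pos _ _).le
    have h2 : ∏ y, psiBar (a y) (Function.update c x 0 y)
        ≤ ∑ s, ∏ y, psiBar (a y) (Function.update c x s y) :=
      Finset.single_le_sum (f := fun s => ∏ y, psiBar (a y) (Function.update c x s y))
        (fun s _ => h0 s) (Finset.mem_univ 0)
    refine le_trans ?_ (mul_le_mul_of_nonneg_left h2 (Real.exp_pos _).le)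
    by_cases hc : c x = 0
    · simp only [hc, ne_eq, not_true_eq_false, if_false, mul_zero]
      exact mul_nonneg (Real.exp_pos _).le (h0 0)
    · rw [if_pos hc, mul_one, ← Finset.mul_prod_erase _ _ (Finset.mem_univ x),
        ← Finset.mul_prod_erase Finset.univ
          (fun y => psiBar (a y) (Function.update c x 0 y)) (Finset.mem_univ x), ← mul_assoc]
      apply le_of_eq
      congr 1
      · simp [psiBar, hc, ← Real.exp_add]
      · refine Finset.prod_congr rfl fun y hy => ?_
        rw [Function.update_of_ne (Finset.ne_of_mem_erase hy)]
  calc _ ≤ ∑ c : C → Fin q,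
        Real.exp (-a x) * ∑ s, ∏ y, psiBar (a y) (Function.update c x s y) :=
        Finset.sum_le_sum fun c _ => h1 c
    _ = Real.exp (-a x) * ((q : ℝ) * ∑ c : C → Fin q, ∏ y, psiBar (a y) (c y)) := by
        rw [← Finset.mul_sum, sum_sum_update x fun c => ∏ y, psiBar (a y) (c y), Fintype.card_fin]
    _ = _ := by ring

/-- `f` depends only on the spins in `U`. -/
def DependsOnSpins {V α : Type*} (f : (V → α) → ℝ) (U : Finset V) : Prop :=
  ∀ σ τ : V → α, (∀ u ∈ U, σ u = τ u) → f σ = f τ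

theorem DependsOnSpins.update {V α : Type*} [DecidableEq V] {f : (V → α) → ℝ} {U : Finset V}
    (h : DependsOnSpins f U) {a : V} (ha : a ∉ U) (σ : V → α) (s : α) :
    f (Function.update σ a s) = f σ :=
  h _ _ fun _ hu => Function.update_of_ne (ne_of_mem_of_not_mem hu ha) _ _

/-- Spins outside `U` do not matter and spins of bias `0` are uniform, so only the factors of `S`
remain. -/
theorem prod_biasVec_extend {V : Type*} [Fintype V] [DecidableEq V] (b : V → ℝ)
    {S U : Finset V} (hSU : S ⊆ U) (hb : ∀ u ∈ U, u ∉ S → b u = 0) (f : (V → Fin q) → ℝ)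
    (hf : DependsOnSpins f U) :
    ∑ σ : V → Fin q, (∏ u, biasVec q (b u) (σ u)) * f σ
      = (1 / (q : ℝ)) ^ Sᶜ.card * ∑ σ : V → Fin q, (∏ u ∈ S, biasVec q (b u) (σ u)) * f σ := by
  have h1 : ∀ σ : V → Fin q, (∏ u, biasVec q (b u) (σ u)) * f σ
      = (∏ u ∈ Uᶜ, biasVec q (b u) (σ u)) *
        ((1 / (q : ℝ)) ^ (U \ S).card * ((∏ u ∈ S, biasVec q (b u) (σ u)) * f σ)) := by
    intro σ
    rw [← Finset.prod_compl_mul_prod U, ← Finset.prod_sdiff hSU]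
    have : ∏ u ∈ U \ S, biasVec q (b u) (σ u) = (1 / (q : ℝ)) ^ (U \ S).card := by
      rw [← Finset.prod_const]
      refine Finset.prod_congr rfl fun u hu => ?_
      rw [Finset.mem_sdiff] at hu
      rw [hb u hu.1 hu.2, biasVec_zero]
    rw [this]
    ring
  have hcard : Sᶜ.card = Uᶜ.card + (U \ S).card := by
    rw [← Finset.card_union_of_disjoint]
    · congr 1
      ext x
      have := @hSU x
      simp only [Finset.mem_compl, Finset.mem_union, Finset.mem_sdiff]
      tauto
    · rw [Finset.disjoint_left]
      intro x hx hx'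
      exact (Finset.mem_compl.1 hx) (Finset.mem_sdiff.1 hx').1
  simp only [h1]
  rw [sum_integrate_out Uᶜ (fun c _ s => biasVec q (b c) s) (fun _ _ _ _ _ _ => rfl)]
  · simp only [sum_biasVec, Finset.prod_const_one, one_mul, Fintype.card_fin]
    rw [← Finset.mul_sum, hcard, pow_add]
    ring
  · intro a ha σ s
    rw [Finset.mem_compl] at ha
    rw [hf.update ha]
    congr 2
    refine Finset.prod_congr rfl fun u hu => ?_
    rw [Function.update_of_ne (ne_of_mem_of_not_mem (hSU hu) ha)]

end Cluster

section ClusterMixture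

variable {q : ℕ} [NeZero q]

/-- Spins are constant on the fibres (clusters) of `π`, independent, with weights `psiBar B` at the
vertices of `A`. If every cluster that meets `U` twice meets it in `S` and has at least `k` vertices
in `A`, then on `U` the spins are close to independent spins with biases in `[0, 1]`: a cluster
meeting `U` twice has spin `0` up to a probability of order `exp (-B k)`. -/
theorem exists_product_of_clusters {V C : Type*} [Fintype V] [DecidableEq V] [Fintype C]
    [DecidableEq C] {B : ℝ} (hB : 0 ≤ B) {π : V → C} (hπ : Function.Surjective π)
    {A U S : Finset V} {k : ℕ} (hSU : S ⊆ U) (hUA : ∀ u ∈ U, u ∉ S → ∀ i ∈ A, π i ≠ π u)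
    (hk : ∀ u ∈ U, ∀ u' ∈ U, u ≠ u' → π u = π u' →
      u ∈ S ∧ k ≤ (A.filter (π · = π u)).card) :
    ∃ (w : ℝ) (b : V → ℝ), 0 ≤ w ∧ (∀ u, 0 ≤ b u ∧ b u ≤ 1) ∧
      ∀ f : (V → Fin q) → ℝ, DependsOnSpins f U → (∀ σ, |f σ| ≤ 1) →
        |∑ c : C → Fin q, (∏ i ∈ A, psiBar B (c (π i))) * f (c ∘ π)
          - w * ∑ σ : V → Fin q, (∏ u ∈ S, biasVec q (b u) (σ u)) * f σ|
        ≤ S.card * (q * Real.exp (-(B * k))) * ∑ c : C → Fin q, ∏ i ∈ A, psiBar B (c (π i)) := by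
  have hq1 : (0 : ℝ) ≤ (q : ℝ) - 1 := by
    have : (1 : ℝ) ≤ q := by exact_mod_cast NeZero.one_le
    linarith
  set N : C → ℕ := fun x => (A.filter (π · = x)).card with hN
  -- The clusters that meet `U` twice.
  let bad : C → Prop := fun x => ∃ u ∈ U, ∃ u' ∈ U, u ≠ u' ∧ π u = x ∧ π u' = x
  have hprod : ∀ c : C → Fin q, ∏ i ∈ A, psiBar B (c (π i)) = ∏ x, psiBar (B * N x) (c x) := by
    intro c
    rw [← Finset.prod_fiberwise A π]
    refine Finset.prod_congr rfl fun x _ => ?_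
    rw [← psiBar_pow, hN, ← Finset.prod_const]
    refine Finset.prod_congr rfl fun i hi => ?_
    rw [(Finset.mem_filter.1 hi).2]
  classical
  let bC : C → ℝ := fun x => if bad x then 1 else biasOf q (Real.exp (B * N x)) 1
  let z : C → ℝ := fun x =>
    if bad x then Real.exp (B * N x) else Real.exp (B * N x) + ((q : ℝ) - 1)
  have hz : ∀ x, 0 ≤ z x := by
    intro x
    have := Real.exp_pos (B * N x)
    simp only [z]
    split_ifs <;> positivity
  have hbC : ∀ x, 0 ≤ bC x ∧ bC x ≤ 1 := by
    intro x
    simp only [bC]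
    split_ifs
    · exact ⟨zero_le_one, le_rfl⟩
    · exact ⟨biasOf_nonneg one_pos (Real.one_le_exp (by positivity)),
        biasOf_le_one (Real.exp_pos _) one_pos⟩
  -- Restricting the cluster weights to spin `0` on the clusters that meet `U` twice.
  have hzb : ∀ x s, z x * biasVec q (bC x) s
      = if bad x ∧ s ≠ 0 then 0 else psiBar (B * N x) s := by
    intro x s
    by_cases hx : bad x
    · by_cases hs : s = 0 <;> simp [z, bC, hx, hs, biasVec_one, psiBar]
    · simp only [z, bC, hx, if_false, false_and]
      rw [← psiBar_eq_mul_biasVec]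
  have hgood : ∀ c : C → Fin q, (∏ x, z x * biasVec q (bC x) (c x))
      = if ∃ x, bad x ∧ c x ≠ 0 then 0 else ∏ x, psiBar (B * N x) (c x) := by
    intro c
    simp only [hzb]
    split_ifs with h
    · obtain ⟨x, hx⟩ := h
      exact Finset.prod_eq_zero (Finset.mem_univ x) (if_pos hx)
    · refine Finset.prod_congr rfl fun x _ => if_neg fun hx => h ⟨x, hx⟩
  -- A section of `π` that takes values in `U` where possible.
  have hrep : ∀ x, ∃ v, π v = x ∧ ((∃ u ∈ U, π u = x) → v ∈ U) := by
    intro x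
    by_cases h : ∃ u ∈ U, π u = x
    · obtain ⟨u, hu, hux⟩ := h
      exact ⟨u, hux, fun _ => hu⟩
    · obtain ⟨v, hv⟩ := hπ x
      exact ⟨v, hv, fun h' => absurd h' h⟩
  choose rep hrepπ hrepU using hrep
  have hinj : Function.Injective rep := fun x y h => by rw [← hrepπ x, h, hrepπ]
  have hsame : ∀ u ∈ U, ¬ bad (π u) → rep (π u) = u := by
    intro u hu hb
    by_contra hne
    exact hb ⟨_, hrepU _ ⟨u, hu, rfl⟩, u, hu, hne, hrepπ _, rfl⟩
  refine ⟨(∏ x, z x) * (1 / (q : ℝ)) ^ Sᶜ.card, fun u => bC (π u),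
    mul_nonneg (Finset.prod_nonneg fun x _ => hz x) (by positivity), fun u => hbC _, ?_⟩
  intro f hf hf1
  have hb0 : ∀ u ∈ U, u ∉ S → bC (π u) = 0 := by
    intro u hu huS
    have hnb : ¬ bad (π u) := by
      rintro ⟨a, ha, a', ha', hne, h1, h2⟩
      by_cases hau : a = u
      · rw [hau] at hne
        exact huS (hk u hu a' ha' hne h2.symm).1
      · exact huS (hk u hu a ha (Ne.symm hau) h1.symm).1
    have hN0 : N (π u) = 0 := by
      rw [hN, Finset.card_eq_zero, Finset.filter_eq_empty_iff]
      exact fun i hi => hUA u hu huS i hi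
    simp [bC, hnb, hN0, biasOf]
  have hmain : (∏ x, z x) * (1 / (q : ℝ)) ^ Sᶜ.card *
      ∑ σ : V → Fin q, (∏ u ∈ S, biasVec q (bC (π u)) (σ u)) * f σ
      = ∑ c : C → Fin q, (∏ x, z x * biasVec q (bC x) (c x)) * f (c ∘ π) := by
    rw [mul_assoc, ← prod_biasVec_extend (fun u => bC (π u)) hSU hb0 f hf]
    have h1 : ∀ σ : V → Fin q, (∏ u, biasVec q (bC (π u)) (σ u)) * f σ
        = (∏ u, biasVec q (bC (π u)) (σ u)) * f ((σ ∘ rep) ∘ π) := by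
      intro σ
      by_cases h : ∃ u, bad (π u) ∧ σ u ≠ 0
      · obtain ⟨u, hu, hσ⟩ := h
        have h0 : ∏ u, biasVec q (bC (π u)) (σ u) = 0 :=
          Finset.prod_eq_zero (Finset.mem_univ u) (by simp [bC, hu, biasVec_one, hσ])
        rw [h0, zero_mul, zero_mul]
      · push Not at h
        congr 1
        apply hf
        intro u hu
        by_cases hb : bad (π u)
        · simp only [Function.comp_apply]
          rw [h u hb, h _ (by rwa [hrepπ])]
        · simp only [Function.comp_apply]
          rw [hsame u hu hb]
    simp only [h1]
    rw [sum_prod_mul_comp_injective hinj (fun u s => biasVec q (bC (π u)) s)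
      (fun u => sum_biasVec _) (fun c => f (c ∘ π))]
    simp only [hrepπ]
    rw [Finset.mul_sum]
    refine Finset.sum_congr rfl fun c _ => ?_
    rw [Finset.prod_mul_distrib, mul_assoc]
  rw [hmain, ← Finset.sum_sub_distrib]
  have hterm : ∀ c : C → Fin q, |(∏ i ∈ A, psiBar B (c (π i))) * f (c ∘ π)
      - (∏ x, z x * biasVec q (bC x) (c x)) * f (c ∘ π)|
      ≤ ∑ u ∈ S with bad (π u),
        (∏ x, psiBar (B * N x) (c x)) * (if c (π u) ≠ 0 then 1 else 0) := by
    intro c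
    have hpos : 0 ≤ ∏ x, psiBar (B * N x) (c x) :=
      Finset.prod_nonneg fun x _ => (psiBar_pos _ _).le
    rw [hprod, hgood, ← sub_mul, abs_mul]
    refine (mul_le_of_le_one_right (abs_nonneg _) (hf1 _)).trans ?_
    have hnn : ∀ u ∈ S.filter (fun u => bad (π u)),
        0 ≤ (∏ x, psiBar (B * N x) (c x)) * (if c (π u) ≠ 0 then (1 : ℝ) else 0) := by
      intro u _
      split_ifs <;> simp [hpos]
    split_ifs with h
    · obtain ⟨x, hx, hcx⟩ := h
      obtain ⟨u, hu, u', hu', hne, h1, h2⟩ := hx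
      have huS : u ∈ S := (hk u hu u' hu' hne (h1.trans h2.symm)).1
      rw [sub_zero, abs_of_nonneg hpos]
      have hmem : u ∈ S.filter (fun u => bad (π u)) :=
        Finset.mem_filter.2 ⟨huS, u, hu, u', hu', hne, rfl, h2.trans h1.symm⟩
      refine le_trans (le_of_eq ?_) (Finset.single_le_sum hnn hmem)
      rw [h1, if_pos hcx, mul_one]
    · rw [sub_self, abs_zero]
      exact Finset.sum_nonneg hnn
  refine (Finset.abs_sum_le_sum_abs _ _).trans ((Finset.sum_le_sum fun c _ => hterm c).trans ?_)
  rw [Finset.sum_comm]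
  simp only [hprod]
  have hZ : 0 ≤ ∑ c : C → Fin q, ∏ x, psiBar (B * N x) (c x) :=
    Finset.sum_nonneg fun c _ => Finset.prod_nonneg fun x _ => (psiBar_pos _ _).le
  calc _ ≤ ∑ u ∈ S with bad (π u),
        q * Real.exp (-(B * k)) * ∑ c : C → Fin q, ∏ x, psiBar (B * N x) (c x) := by
        refine Finset.sum_le_sum fun u hu => ?_
        rw [Finset.mem_filter] at hu
        refine (sum_prod_psiBar_ne_zero_le _ (π u)).trans ?_
        have hkN : k ≤ N (π u) := by
          obtain ⟨huS, a, ha, a', ha', hne, h1, h2⟩ := hu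
          have := (hk a ha a' ha' hne (h1.trans h2.symm)).2
          rwa [h1] at this
        have : (k : ℝ) ≤ N (π u) := by exact_mod_cast hkN
        gcongr
    _ = ((S.filter (fun u => bad (π u))).card : ℝ) *
        (q * Real.exp (-(B * k)) * ∑ c : C → Fin q, ∏ x, psiBar (B * N x) (c x)) := by
        rw [Finset.sum_const, nsmul_eq_mul]
    _ ≤ S.card * (q * Real.exp (-(B * k)) *
          ∑ c : C → Fin q, ∏ x, psiBar (B * N x) (c x)) := by
        gcongr
        exact Finset.filter_subset _ _
    _ = _ := by ring

end ClusterMixture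

/-! ### The random cluster expansion -/

section FK

variable {V : Type*} [Fintype V] [DecidableEq V] {q : ℕ} [NeZero q]

/-- The weight `psi β (σ i) (σ j)` of an edge `s(i, j)`. -/
def edgeWeight (β : ℝ) (σ : V → Fin q) (e : Sym2 V) : ℝ :=
  Sym2.lift ⟨fun i j => psi β (σ i) (σ j), fun _ _ => psi_comm β _ _⟩ e

/-- The Potts weight of the edges in `E` and the vertices in `A`. The configuration is defined on
all of `V`; the spins that do not enter are free. -/
def partialWeight (β B : ℝ) (E : Finset (Sym2 V)) (A : Finset V) (σ : V → Fin q) : ℝ :=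
  (∏ e ∈ E, edgeWeight β σ e) * ∏ i ∈ A, psiBar B (σ i)

theorem psi_pos {q : ℕ} (β : ℝ) (s s' : Fin q) : 0 < psi β s s' := Real.exp_pos _

theorem edgeWeight_pos {V : Type*} {q : ℕ} (β : ℝ) (σ : V → Fin q) (e : Sym2 V) : 0 < edgeWeight β σ e := by
  induction e with
  | _ i j => exact psi_pos _ _ _

theorem partialWeight_pos {V : Type*} (β B : ℝ) (E : Finset (Sym2 V)) (A : Finset V) (σ : V → Fin q) :
    0 < partialWeight β B E A σ :=
  mul_pos (Finset.prod_pos fun _ _ => edgeWeight_pos _ _ _)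
    (Finset.prod_pos fun _ _ => psiBar_pos _ _)

open Classical in
theorem edgeWeight_eq {V : Type*} {q : ℕ} (β : ℝ) (σ : V → Fin q) (e : Sym2 V) :
    edgeWeight β σ e = 1 + (Real.exp β - 1) * if (e.map σ).IsDiag then 1 else 0 := by
  induction e with
  | _ i j =>
    by_cases h : σ i = σ j <;> simp [edgeWeight, psi, h]

open Classical in
/-- The random cluster expansion: `η` is the set of open bonds. -/
theorem prod_edgeWeight_eq {q : ℕ} (β : ℝ) (E : Finset (Sym2 V)) (σ : V → Fin q) :
    ∏ e ∈ E, edgeWeight β σ e = ∑ η ∈ E.powerset,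
      (Real.exp β - 1) ^ η.card * if ∀ e ∈ η, (e.map σ).IsDiag then 1 else 0 := by
  simp only [edgeWeight_eq]
  rw [Finset.prod_one_add]
  refine Finset.sum_congr rfl fun η _ => ?_
  rw [Finset.prod_mul_distrib, Finset.prod_const, Finset.prod_ite_zero]
  simp

theorem isDiag_iff_exists_comp {V : Type*} {q : ℕ} (η : Finset (Sym2 V)) (σ : V → Fin q) :
    (∀ e ∈ η, (e.map σ).IsDiag) ↔
      ∃ c : (SimpleGraph.fromEdgeSet (η : Set (Sym2 V))).ConnectedComponent → Fin q,
        c ∘ SimpleGraph.connectedComponentMk _ = σ := by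
  constructor
  · intro h
    have hw : ∀ u w, (SimpleGraph.fromEdgeSet (η : Set (Sym2 V))).Walk u w → σ u = σ w := by
      intro u w p
      induction p with
      | nil => rfl
      | @cons u x w hux p ih =>
        rw [← ih]
        rw [SimpleGraph.fromEdgeSet_adj] at hux
        simpa using h _ hux.1
    exact ⟨SimpleGraph.ConnectedComponent.lift σ fun u w p _ => hw u w p, rfl⟩
  · rintro ⟨c, rfl⟩ e he
    induction e with
    | _ i j =>
      by_cases hij : i = j
      · simp [hij]
      · have hadj : (SimpleGraph.fromEdgeSet (η : Set (Sym2 V))).Adj i j :=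
          (SimpleGraph.fromEdgeSet_adj _).2 ⟨he, hij⟩
        simp only [Sym2.map_mk, Sym2.mk_isDiag_iff, Function.comp_apply]
        rw [SimpleGraph.ConnectedComponent.sound hadj.reachable]

open Classical in
theorem sum_isDiag_mul {q : ℕ} (η : Finset (Sym2 V)) (Φ : (V → Fin q) → ℝ) :
    ∑ σ : V → Fin q, (if ∀ e ∈ η, (e.map σ).IsDiag then 1 else 0) * Φ σ
      = ∑ c : (SimpleGraph.fromEdgeSet (η : Set (Sym2 V))).ConnectedComponent → Fin q,
          Φ (c ∘ SimpleGraph.connectedComponentMk _) := by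
  symm
  have hsurj : Function.Surjective
      (SimpleGraph.connectedComponentMk (SimpleGraph.fromEdgeSet (η : Set (Sym2 V)))) :=
    Quot.mk_surjective
  apply Fintype.sum_of_injective
    (fun c => c ∘ SimpleGraph.connectedComponentMk _) hsurj.injective_comp_right
  · intro σ hσ
    rw [if_neg, zero_mul]
    rwa [isDiag_iff_exists_comp]
  · intro c
    rw [if_pos ((isDiag_iff_exists_comp _ _).2 ⟨c, rfl⟩), one_mul]

/-- Up to a relative error `δ`, the weight `M` restricted to `U` is a mixture of product weights:
uniform on `U \ S`, and on `S` given by probability vectors with biases in `[lo, hi]`. The closeness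
is in the `ℓ¹` norm, expressed by test functions `f`. The mixture is indexed by the bond
configurations of the random cluster expansion. -/
def ApproxMixture (M : (V → Fin q) → ℝ) (U S : Finset V) (lo hi δ : ℝ) : Prop :=
  ∃ (w : Finset (Sym2 V) → ℝ) (b : Finset (Sym2 V) → V → ℝ), (∀ η, 0 ≤ w η) ∧
    (∀ η, ∀ u ∈ S, lo ≤ b η u ∧ b η u ≤ hi) ∧
    ∀ f : (V → Fin q) → ℝ, DependsOnSpins f U → (∀ σ, |f σ| ≤ 1) →
      |∑ σ, M σ * f σ
          - ∑ η, w η * ∑ σ : V → Fin q, (∏ u ∈ S, biasVec q (b η u) (σ u)) * f σ|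
        ≤ δ * ∑ σ, M σ

/-- Conditionally on the open bonds the spins are independent over the clusters, so the Potts weight
is an approximate mixture as soon as every cluster of open bonds that contains two vertices of `S`
has at least `k` vertices in `A`. -/
theorem approxMixture_of_clusters {β B : ℝ} (hβ : 0 ≤ β) (hB : 0 ≤ B) {E : Finset (Sym2 V)}
    {A U S : Finset V} {k : ℕ} (hSU : S ⊆ U) (hUA : ∀ u ∈ U, u ∉ S → u ∉ A)
    (hUE : ∀ u ∈ U, u ∉ S → ∀ e ∈ E, u ∉ e)
    (hk : ∀ H : SimpleGraph V, (∀ a b, H.Adj a b → s(a, b) ∈ E) → ∀ u ∈ S, ∀ u' ∈ S, u ≠ u' →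
      H.Reachable u u' → ∀ C : Finset V, (∀ x ∈ A, H.Reachable u x → x ∈ C) → k ≤ C.card) :
    ApproxMixture (partialWeight β B E A : (V → Fin q) → ℝ) U S 0 1
      (S.card * (q * Real.exp (-(B * k)))) := by
  classical
  have hE : 0 ≤ Real.exp β - 1 := by linarith [Real.one_le_exp hβ]
  have hex : ∀ η : Finset (Sym2 V), ∃ (w : ℝ) (b : V → ℝ), 0 ≤ w ∧ (∀ u, 0 ≤ b u ∧ b u ≤ 1) ∧
      (η ⊆ E → ∀ f : (V → Fin q) → ℝ, DependsOnSpins f U → (∀ σ, |f σ| ≤ 1) →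
        |∑ σ : V → Fin q, (if ∀ e ∈ η, (e.map σ).IsDiag then 1 else 0) *
              ((∏ i ∈ A, psiBar B (σ i)) * f σ)
            - w * ∑ σ : V → Fin q, (∏ u ∈ S, biasVec q (b u) (σ u)) * f σ|
          ≤ S.card * (q * Real.exp (-(B * k))) *
            ∑ σ : V → Fin q, (if ∀ e ∈ η, (e.map σ).IsDiag then 1 else 0) *
              ∏ i ∈ A, psiBar B (σ i)) := by
    intro η
    by_cases hη : η ⊆ E
    · set H := SimpleGraph.fromEdgeSet (η : Set (Sym2 V)) with hH
      have hHE : ∀ a b, H.Adj a b → s(a, b) ∈ E := fun a b hab =>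
        hη ((SimpleGraph.fromEdgeSet_adj _).1 hab).1
      have hiso : ∀ u ∈ U, ∀ x, u ≠ x → H.Reachable u x → u ∈ S := by
        intro u hu x hne ⟨p⟩
        by_contra huS
        cases p with
        | nil => exact hne rfl
        | cons h _ => exact hUE u hu huS _ (hHE _ _ h) (Sym2.mem_mk_left _ _)
      obtain ⟨w, b, hw, hb, hf⟩ := exists_product_of_clusters (q := q) (B := B) hB
        (π := H.connectedComponentMk) Quot.mk_surjective (A := A) (U := U) (S := S) (k := k)
        hSU (by
          intro u hu huS i hi h
          have hne : u ≠ i := fun h' => hUA u hu huS (h' ▸ hi)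
          exact huS (hiso u hu i hne (SimpleGraph.ConnectedComponent.exact h.symm)))
        (by
          intro u hu u' hu' hne h
          have hr := SimpleGraph.ConnectedComponent.exact h
          have huS := hiso u hu u' hne hr
          refine ⟨huS, hk H hHE u huS u' (hiso u' hu' u hne.symm hr.symm) hne hr _ ?_⟩
          intro x hx hux
          exact Finset.mem_filter.2 ⟨hx, SimpleGraph.ConnectedComponent.sound hux.symm⟩)
      refine ⟨w, b, hw, hb, fun _ f hfU hf1 => ?_⟩
      rw [sum_isDiag_mul, sum_isDiag_mul]
      exact hf f hfU hf1
    · exact ⟨0, 0, le_rfl, fun u => ⟨le_rfl, zero_le_one⟩, fun h => absurd h hη⟩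
  choose w b hw hb hf using hex
  refine ⟨fun η => if η ⊆ E then (Real.exp β - 1) ^ η.card * w η else 0, b, ?_,
    fun η u _ => hb η u, ?_⟩
  · intro η
    have := hw η
    simp only
    split_ifs
    · positivity
    · exact le_rfl
  intro f hfU hf1
  have hexp : ∀ g : (V → Fin q) → ℝ, ∑ σ, partialWeight β B E A σ * g σ
      = ∑ η ∈ E.powerset, (Real.exp β - 1) ^ η.card *
        ∑ σ : V → Fin q, (if ∀ e ∈ η, (e.map σ).IsDiag then 1 else 0) *
          ((∏ i ∈ A, psiBar B (σ i)) * g σ) := by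
    intro g
    simp only [Finset.mul_sum]
    rw [Finset.sum_comm]
    refine Finset.sum_congr rfl fun σ _ => ?_
    rw [partialWeight, prod_edgeWeight_eq, mul_assoc, Finset.sum_mul]
    exact Finset.sum_congr rfl fun η _ => by ring
  have hmix : ∑ η, (if η ⊆ E then (Real.exp β - 1) ^ η.card * w η else 0) *
        ∑ σ : V → Fin q, (∏ u ∈ S, biasVec q (b η u) (σ u)) * f σ
      = ∑ η ∈ E.powerset, (Real.exp β - 1) ^ η.card *
        (w η * ∑ σ : V → Fin q, (∏ u ∈ S, biasVec q (b η u) (σ u)) * f σ) := by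
    have hps : E.powerset = Finset.univ.filter (· ⊆ E) := by ext; simp
    rw [hps, Finset.sum_filter]
    refine Finset.sum_congr rfl fun η _ => ?_
    split_ifs <;> ring
  have hone := hexp 1
  simp only [Pi.one_apply, mul_one] at hone
  rw [hexp f, hone, hmix, ← Finset.sum_sub_distrib, Finset.mul_sum]
  refine (Finset.abs_sum_le_sum_abs _ _).trans (Finset.sum_le_sum fun η hη => ?_)
  rw [← mul_sub, abs_mul, abs_of_nonneg (by positivity), mul_left_comm]
  exact mul_le_mul_of_nonneg_left (hf η (Finset.mem_powerset.1 hη) f hfU hf1) (by positivity)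

end FK

/-! ### From one sphere to the next -/

section Step

variable {V : Type*} [Fintype V] [DecidableEq V] {q : ℕ} [NeZero q]

open Classical in
/-- The edges of `G` between vertices of level at least `k`. -/
def levelEdges (G : SimpleGraph V) (lev : V → ℕ) (k : ℕ) : Finset (Sym2 V) :=
  {e | e ∈ G.edgeSet ∧ ∀ x ∈ e, k ≤ lev x}

/-- The Potts weight of the subgraph of `G` induced by the vertices of level at least `k`. -/
def levelWeight (β B : ℝ) (G : SimpleGraph V) (lev : V → ℕ) (k : ℕ) (σ : V → Fin q) : ℝ :=
  partialWeight β B (levelEdges G lev k) {u | k ≤ lev u} σ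

/-- The weight that the vertices of level `k` and the edges to their children bring in. -/
def layerWeight (β B : ℝ) (lev : V → ℕ) (par : V → V) (k : ℕ) (σ : V → Fin q) : ℝ :=
  (∏ u with lev u = k, psiBar B (σ u)) * ∏ c with lev c = k + 1, psi β (σ (par c)) (σ c)

variable {G : SimpleGraph V} {t : ℕ} {v : V} {lev : V → ℕ} {par : V → V}

theorem mem_levelEdges {k : ℕ} {a b : V} :
    s(a, b) ∈ levelEdges G lev k ↔ G.Adj a b ∧ k ≤ lev a ∧ k ≤ lev b := by
  simp [levelEdges]

theorem IsTreeLevel.levelWeight_eq (h : IsTreeLevel G t v lev par) (β B : ℝ) {k : ℕ}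
    (hk : k + 1 ≤ t) (σ : V → Fin q) :
    levelWeight β B G lev k σ = levelWeight β B G lev (k + 1) σ * layerWeight β B lev par k σ := by
  have hpar : ∀ c, lev c = k + 1 → G.Adj (par c) c ∧ lev (par c) = k := by
    intro c hc
    refine ⟨(h.adj_par c (by omega) (by omega)).symm, ?_⟩
    have := h.lev_par c (by omega) (by omega)
    omega
  have hE : levelEdges G lev k = levelEdges G lev (k + 1) ∪
      ({c | lev c = k + 1} : Finset V).image (fun c => s(par c, c)) := by
    ext e
    induction e with
    | _ a b =>
      simp only [Finset.mem_union, mem_levelEdges, Finset.mem_image, Finset.mem_filter,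
        Finset.mem_univ, true_and]
      constructor
      · rintro ⟨hab, ha, hb⟩
        have h1 := h.le_add_one _ _ hab
        have h2 := h.le_add_one _ _ hab.symm
        by_cases ha' : lev a = k
        · have h3 := h.ne_of_adj _ _ hab (by omega)
          refine .inr ⟨b, by omega, ?_⟩
          rw [← h.eq_par b a (by omega) hab.symm (by omega)]
        · by_cases hb' : lev b = k
          · refine .inr ⟨a, by omega, ?_⟩
            rw [← h.eq_par a b (by omega) hab (by omega), Sym2.eq_swap]
          · exact .inl ⟨hab, by omega, by omega⟩
      · rintro (⟨hab, ha, hb⟩ | ⟨c, hc, he⟩)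
        · exact ⟨hab, by omega, by omega⟩
        · obtain ⟨h1, h2⟩ := hpar c hc
          rcases Sym2.eq_iff.1 he with ⟨rfl, rfl⟩ | ⟨rfl, rfl⟩
          · exact ⟨h1, by omega, by omega⟩
          · exact ⟨h1.symm, by omega, by omega⟩
  have hdisj : Disjoint (levelEdges G lev (k + 1))
      (({c | lev c = k + 1} : Finset V).image (fun c => s(par c, c))) := by
    rw [Finset.disjoint_right]
    intro e he
    simp only [Finset.mem_image, Finset.mem_filter, Finset.mem_univ, true_and] at he
    obtain ⟨c, hc, rfl⟩ := he
    rw [mem_levelEdges]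
    have := hpar c hc
    omega
  have hinj : Set.InjOn (fun c => s(par c, c)) ({c | lev c = k + 1} : Finset V) := by
    intro c hc c' hc' he
    simp only [Finset.coe_filter, Finset.mem_univ, true_and, Set.mem_ofPred_eq] at hc hc'
    rcases Sym2.eq_iff.1 he with ⟨-, h1⟩ | ⟨h1, -⟩
    · exact h1
    · have := (hpar c hc).2
      rw [h1] at this
      omega
  have hA : ({u | k ≤ lev u} : Finset V)
      = ({u | k + 1 ≤ lev u} : Finset V) ∪ ({u | lev u = k} : Finset V) := by
    ext u
    simp only [Finset.mem_union, Finset.mem_filter, Finset.mem_univ, true_and]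
    omega
  have hdisjA : Disjoint ({u | k + 1 ≤ lev u} : Finset V) ({u | lev u = k} : Finset V) := by
    rw [Finset.disjoint_filter]
    intro u _ h1
    omega
  unfold levelWeight partialWeight layerWeight
  rw [hE, Finset.prod_union hdisj, Finset.prod_image hinj, hA, Finset.prod_union hdisjA]
  simp only [edgeWeight, Sym2.lift_mk]
  ring

theorem one_le_psi {q : ℕ} {β : ℝ} (hβ : 0 ≤ β) (s s' : Fin q) : 1 ≤ psi β s s' := by
  apply Real.one_le_exp
  split_ifs <;> simp [hβ]

theorem one_le_layerWeight {V : Type*} [Fintype V] {β B : ℝ} (hβ : 0 ≤ β) (hB : 0 ≤ B)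
    (lev : V → ℕ) (par : V → V) (k : ℕ) (σ : V → Fin q) :
    1 ≤ layerWeight β B lev par k σ :=
  one_le_mul_of_one_le_of_one_le
    (Finset.one_le_prod fun u _ => one_le_psiBar hB (σ u))
    (Finset.one_le_prod fun _ _ => one_le_psi hβ _ _)

theorem IsTreeLevel.layerWeight_le [G.LocallyFinite] {d : ℕ} (h : IsTreeLevel G t v lev par)
    (hG : G.IsRegularOfDegree d) (hd : 1 ≤ d) {β B : ℝ} (hβ : 0 ≤ β) (hB : 0 ≤ B) {k : ℕ}
    (hk : k + 1 ≤ t) (σ : V → Fin q) :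
    layerWeight β B lev par k σ ≤ Real.exp ((B + β) * d ^ (k + 1)) := by
  have h1 : ∏ u with lev u = k, psiBar B (σ u) ≤ Real.exp (B * d ^ (k + 1)) := by
    have hle : ∀ s : Fin q, psiBar B s ≤ Real.exp B := by
      intro s
      apply Real.exp_le_exp.2
      split_ifs <;> simp [hB]
    calc ∏ u with lev u = k, psiBar B (σ u)
        ≤ ∏ u with lev u = k, Real.exp B :=
          Finset.prod_le_prod (fun _ _ => (psiBar_pos _ _).le) fun _ _ => hle _
      _ = Real.exp (B * ({u | lev u = k} : Finset V).card) := by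
          rw [Finset.prod_const, ← Real.exp_nat_mul, mul_comm]
      _ ≤ _ := by
          have h2 : (({u | lev u = k} : Finset V).card : ℝ) ≤ (d : ℝ) ^ k := by
            exact_mod_cast h.card_level_le hG (by omega)
          have h3 : (d : ℝ) ^ k ≤ (d : ℝ) ^ (k + 1) :=
            pow_le_pow_right₀ (by exact_mod_cast hd) (by omega)
          have := h2.trans h3
          gcongr
  have h2 : ∏ c with lev c = k + 1, psi β (σ (par c)) (σ c) ≤ Real.exp (β * d ^ (k + 1)) := by
    have hle : ∀ s s' : Fin q, psi β s s' ≤ Real.exp β := by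
      intro s s'
      apply Real.exp_le_exp.2
      split_ifs <;> simp [hβ]
    calc ∏ c with lev c = k + 1, psi β (σ (par c)) (σ c)
        ≤ ∏ u with lev u = k + 1, Real.exp β :=
          Finset.prod_le_prod (fun _ _ => (psi_pos _ _ _).le) fun _ _ => hle _ _
      _ = Real.exp (β * ({u | lev u = k + 1} : Finset V).card) := by
          rw [Finset.prod_const, ← Real.exp_nat_mul, mul_comm]
      _ ≤ _ := by
          have h2 : (({u | lev u = k + 1} : Finset V).card : ℝ) ≤ (d : ℝ) ^ (k + 1) := by
            exact_mod_cast h.card_level_le hG hk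
          gcongr
  calc layerWeight β B lev par k σ
      ≤ Real.exp (B * d ^ (k + 1)) * Real.exp (β * d ^ (k + 1)) :=
        mul_le_mul h1 h2 (Finset.prod_nonneg fun _ _ => (psi_pos _ _ _).le) (Real.exp_pos _).le
    _ = _ := by rw [← Real.exp_add, ← add_mul]

/-- Summing out the spins of level `k + 1` in a product weight gives a product weight on
level `k`, with biases given by belief propagation. -/
theorem IsTreeLevel.exists_product_of_layer [G.LocallyFinite] {d : ℕ}
    (h : IsTreeLevel G t v lev par) (hG : G.IsRegularOfDegree d) (hq : 2 ≤ q) {β : ℝ}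
    (hβ : 0 ≤ β) (B : ℝ) {k : ℕ} (hk1 : 1 ≤ k) (hk : k + 1 ≤ t) {lo hi : ℝ} (hlo : 0 ≤ lo)
    (hlohi : lo ≤ hi) (hhi : hi ≤ 1) (b : V → ℝ) (hb : ∀ c, lev c = k + 1 → lo ≤ b c ∧ b c ≤ hi) :
    ∃ (w : ℝ) (b' : V → ℝ), 0 ≤ w ∧
      (∀ u, lev u = k → bp d q β B lo ≤ b' u ∧ b' u ≤ bp d q β B hi) ∧
      ∀ f : (V → Fin q) → ℝ, DependsOnSpins f {u | lev u ≤ k} →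
        ∑ σ : V → Fin q, (∏ c with lev c = k + 1, biasVec q (b c) (σ c)) *
            (layerWeight β B lev par k σ * f σ)
          = w * ∑ σ : V → Fin q, (∏ u with lev u = k, biasVec q (b' u) (σ u)) * f σ := by
  have hex : ∀ u, ∃ z b' : ℝ, lev u = k → 0 < z ∧ bp d q β B lo ≤ b' ∧ b' ≤ bp d q β B hi ∧
      ∀ s : Fin q, psiBar B s * ∏ c ∈ ({c | lev c = k + 1} : Finset V).filter (par · = u),
        ∑ s', psi β s s' * biasVec q (b c) s' = z * biasVec q b' s := by
    intro u
    by_cases hu : lev u = k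
    · have hcard := h.card_children hG (u := u) (by omega) (by omega)
      rw [hu] at hcard
      obtain ⟨z, b', hz⟩ := exists_bias_of_children (B := B) d hq hβ hlo hhi _ hcard b
        (fun c hc => hb c (Finset.mem_filter.1 (Finset.mem_filter.1 hc).1).2) hlohi
      exact ⟨z, b', fun _ => hz⟩
    · exact ⟨0, 0, fun h => absurd h hu⟩
  choose z b' hz using hex
  have hlevpar : ∀ c, lev c = k + 1 → lev (par c) = k := by
    intro c hc
    have := h.lev_par c (by omega) (by omega)
    omega
  refine ⟨(1 / (q : ℝ)) ^ ({c | lev c = k + 1} : Finset V).card * ∏ u with lev u = k, z u, b',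
    mul_nonneg (by positivity)
      (Finset.prod_nonneg fun u hu => (hz u (Finset.mem_filter.1 hu).2).1.le),
    fun u hu => ⟨(hz u hu).2.1, (hz u hu).2.2.1⟩, ?_⟩
  intro f hf
  have h1 : ∀ σ : V → Fin q, (∏ c with lev c = k + 1, biasVec q (b c) (σ c)) *
      (layerWeight β B lev par k σ * f σ)
      = (∏ c with lev c = k + 1, psi β (σ (par c)) (σ c) * biasVec q (b c) (σ c)) *
        ((∏ u with lev u = k, psiBar B (σ u)) * f σ) := by
    intro σ
    rw [layerWeight, Finset.prod_mul_distrib]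
    ring
  simp only [h1]
  rw [sum_integrate_out ({c | lev c = k + 1} : Finset V)
    (fun c σ s => psi β (σ (par c)) s * biasVec q (b c) s)]
  · rw [Fintype.card_fin, mul_assoc, Finset.mul_sum (a := ∏ u with lev u = k, z u)]
    congr 1
    refine Finset.sum_congr rfl fun σ _ => ?_
    rw [← mul_assoc, ← mul_assoc, ← Finset.prod_mul_distrib, mul_comm (∏ c with _, _)]
    congr 1
    rw [← Finset.prod_fiberwise_of_maps_to (s := ({c | lev c = k + 1} : Finset V))
      (t := ({u | lev u = k} : Finset V)) (g := par)
      (fun c hc => Finset.mem_filter.2 ⟨Finset.mem_univ _, hlevpar c (Finset.mem_filter.1 hc).2⟩),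
      ← Finset.prod_mul_distrib]
    refine Finset.prod_congr rfl fun u hu => ?_
    rw [← (hz u (Finset.mem_filter.1 hu).2).2.2.2 (σ u)]
    congr 1
    refine Finset.prod_congr rfl fun c hc => ?_
    rw [(Finset.mem_filter.1 hc).2]
  · intro c hc a ha σ s
    have hc' := hlevpar c (Finset.mem_filter.1 hc).2
    have ha' := (Finset.mem_filter.1 ha).2
    have hne : par c ≠ a := fun h => by rw [h] at hc'; omega
    simp only [Function.update_of_ne hne]
  · intro a ha σ s
    have ha' := (Finset.mem_filter.1 ha).2
    rw [hf.update (by simp [ha'])]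
    congr 1
    refine Finset.prod_congr rfl fun u hu => ?_
    have hu' := (Finset.mem_filter.1 hu).2
    rw [Function.update_of_ne fun h => by rw [h] at hu'; omega]

/-- Passing from level `k + 1` to level `k`. The test function for level `k` is multiplied by the
layer weight, which takes values between `1` and the constant that amplifies the error. -/
theorem IsTreeLevel.approxMixture_step [G.LocallyFinite] {d : ℕ}
    (h : IsTreeLevel G t v lev par) (hG : G.IsRegularOfDegree d) (hd : 1 ≤ d) (hq : 2 ≤ q)
    {β B : ℝ} (hβ : 0 ≤ β) (hB : 0 ≤ B) {k : ℕ} (hk1 : 1 ≤ k) (hk : k + 1 ≤ t) {lo hi δ : ℝ}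
    (hlo : 0 ≤ lo) (hlohi : lo ≤ hi) (hhi : hi ≤ 1) (hδ : 0 ≤ δ)
    (hmix : ApproxMixture (levelWeight β B G lev (k + 1) : (V → Fin q) → ℝ)
      {u | lev u ≤ k + 1} {u | lev u = k + 1} lo hi δ) :
    ApproxMixture (levelWeight β B G lev k : (V → Fin q) → ℝ)
      {u | lev u ≤ k} {u | lev u = k} (bp d q β B lo) (bp d q β B hi)
      (δ * Real.exp ((B + β) * d ^ (k + 1))) := by
  obtain ⟨w, b, hw, hb, hf⟩ := hmix
  have hex := fun η => h.exists_product_of_layer hG hq hβ B hk1 hk hlo hlohi hhi (b η)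
    fun c hc => hb η c (by simp [hc])
  choose w' b' hw' hb' hf' using hex
  refine ⟨fun η => w η * w' η, b', fun η => mul_nonneg (hw η) (hw' η),
    fun η u hu => hb' η u (Finset.mem_filter.1 hu).2, ?_⟩
  intro f hfU hf1
  set κ := Real.exp ((B + β) * d ^ (k + 1)) with hκ
  have hκ0 : 0 < κ := Real.exp_pos _
  have hL0 : ∀ σ : V → Fin q, 0 < layerWeight β B lev par k σ := fun σ =>
    one_pos.trans_le (one_le_layerWeight hβ hB lev par k σ)
  have key := hf (fun σ => κ⁻¹ * (layerWeight β B lev par k σ * f σ)) (by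
      intro σ τ hστ
      have h1 : f σ = f τ := hfU σ τ fun u hu => hστ u (by
        simp only [Finset.mem_filter, Finset.mem_univ, true_and] at hu ⊢
        omega)
      have h2 : layerWeight β B lev par k σ = layerWeight β B lev par k τ := by
        unfold layerWeight
        congr 1
        · refine Finset.prod_congr rfl fun u hu => ?_
          rw [hστ u (by simp [(Finset.mem_filter.1 hu).2])]
        · refine Finset.prod_congr rfl fun c hc => ?_
          have hc' := (Finset.mem_filter.1 hc).2
          have := h.lev_par c (by omega) (by omega)
          rw [hστ c (by simp [hc']), hστ (par c) (by simp; omega)]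
      simp only [h1, h2])
    (by
      intro σ
      rw [abs_mul, abs_mul, abs_of_pos (inv_pos.2 hκ0), abs_of_pos (hL0 σ),
        inv_mul_le_iff₀ hκ0]
      exact mul_le_mul (h.layerWeight_le hG hd hβ hB hk σ) (hf1 σ) (abs_nonneg _) hκ0.le)
  have h1 : ∑ σ : V → Fin q, levelWeight β B G lev (k + 1) σ *
      (κ⁻¹ * (layerWeight β B lev par k σ * f σ))
      = κ⁻¹ * ∑ σ : V → Fin q, levelWeight β B G lev k σ * f σ := by
    rw [Finset.mul_sum]
    refine Finset.sum_congr rfl fun σ _ => ?_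
    rw [h.levelWeight_eq β B hk σ]
    ring
  have h2 : ∑ η, w η * ∑ σ : V → Fin q, (∏ u with lev u = k + 1, biasVec q (b η u) (σ u)) *
      (κ⁻¹ * (layerWeight β B lev par k σ * f σ))
      = κ⁻¹ * ∑ η, w η * w' η *
        ∑ σ : V → Fin q, (∏ u with lev u = k, biasVec q (b' η u) (σ u)) * f σ := by
    rw [Finset.mul_sum]
    refine Finset.sum_congr rfl fun η _ => ?_
    rw [mul_assoc (w η), ← hf' η f hfU, mul_left_comm, Finset.mul_sum (a := κ⁻¹)]
    congr 1
    exact Finset.sum_congr rfl fun σ _ => by ring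
  rw [h1, h2, ← mul_sub, abs_mul, abs_of_pos (inv_pos.2 hκ0), inv_mul_le_iff₀ hκ0] at key
  have h3 : ∑ σ : V → Fin q, levelWeight β B G lev (k + 1) σ
      ≤ ∑ σ : V → Fin q, levelWeight β B G lev k σ := by
    refine Finset.sum_le_sum fun σ _ => ?_
    rw [h.levelWeight_eq β B hk σ]
    exact le_mul_of_one_le_right (partialWeight_pos _ _ _ _ _).le
      (one_le_layerWeight hβ hB lev par k σ)
  calc _ ≤ _ := key
    _ ≤ κ * (δ * ∑ σ : V → Fin q, levelWeight β B G lev k σ) := by gcongr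
    _ = _ := by ring

theorem ApproxMixture.mono {M : (V → Fin q) → ℝ} (hM : ∀ σ, 0 ≤ M σ) {U S : Finset V}
    {lo hi δ δ' : ℝ} (h : ApproxMixture M U S lo hi δ) (hδ : δ ≤ δ') :
    ApproxMixture M U S lo hi δ' := by
  obtain ⟨w, b, hw, hb, hf⟩ := h
  exact ⟨w, b, hw, hb, fun f hU h1 => (hf f hU h1).trans
    (mul_le_mul_of_nonneg_right hδ (Finset.sum_nonneg fun σ _ => hM σ))⟩

theorem iterate_bp_zero_le_one (d : ℕ) (hq : 2 ≤ q) {β B : ℝ} (hβ : 0 ≤ β) (hB : 0 ≤ B) (j : ℕ) :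
    (bp d q β B)^[j] 0 ≤ (bp d q β B)^[j] 1 := by
  induction j with
  | zero => exact zero_le_one
  | succ j ih =>
    rw [Function.iterate_succ_apply', Function.iterate_succ_apply']
    exact (bp_mono d hq hβ hB (bp_iterate_mem d hq hβ hB le_rfl zero_le_one j).1 ih
      (bp_iterate_mem d hq hβ hB zero_le_one le_rfl j).2).2.1

/-- The factor in front of `exp (-B t)` in the error at level `1`: there are at most `d ^ r` vertices on
level `r`, a bad cluster contributes at most `q * exp (-B (t - r))`, and the step from level `k + 1` to
level `k` multiplies the error by at most `exp ((B + β) * d ^ (k + 1))`. -/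
def amplification (d q : ℕ) (β B : ℝ) (r : ℕ) : ℝ :=
  d ^ r * q * Real.exp (B * r) * ∏ k ∈ Finset.Ico 1 r, Real.exp ((B + β) * d ^ (k + 1))

theorem IsTreeLevel.approxMixture_top [G.LocallyFinite] {d : ℕ}
    (h : IsTreeLevel G t v lev par) (hG : G.IsRegularOfDegree d) {β B : ℝ} (hβ : 0 ≤ β)
    (hB : 0 ≤ B) {r : ℕ} (hr : r ≤ t) :
    ApproxMixture (levelWeight β B G lev r : (V → Fin q) → ℝ) {u | lev u ≤ r} {u | lev u = r} 0 1
      (d ^ r * q * Real.exp (B * r) * Real.exp (-(B * t))) := by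
  refine (approxMixture_of_clusters (q := q) hβ hB (k := t - r) ?_ ?_ ?_ ?_).mono
    (fun σ => (partialWeight_pos _ _ _ _ _).le) ?_
  · intro u hu
    simp only [Finset.mem_filter, Finset.mem_univ, true_and] at hu ⊢
    omega
  · intro u hu hu'
    simp only [Finset.mem_filter, Finset.mem_univ, true_and] at hu hu' ⊢
    omega
  · intro u hu hu' e he hue
    simp only [Finset.mem_filter, Finset.mem_univ, true_and] at hu hu'
    simp only [levelEdges, Finset.mem_filter] at he
    have := he.2.2 u hue
    omega
  · intro H hH u hu u' hu' hne hreach C hC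
    have hadj := fun a b hab => mem_levelEdges.1 (hH a b hab)
    refine h.le_card_cluster (fun a b hab => (hadj a b hab).1) (fun a b hab => (hadj a b hab).2.1)
      (Finset.mem_filter.1 hu).2 (Finset.mem_filter.1 hu').2 hne hreach C
      fun x hx hrx => hC x (by simpa using hrx) hx
  · have hcard : (({u | lev u = r} : Finset V).card : ℝ) ≤ (d : ℝ) ^ r := by
      exact_mod_cast h.card_level_le hG hr
    have hexp : Real.exp (-(B * (t - r : ℕ))) = Real.exp (B * r) * Real.exp (-(B * t)) := by
      rw [← Real.exp_add, Nat.cast_sub hr]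
      congr 1
      ring
    calc _ ≤ (d : ℝ) ^ r * (q * Real.exp (-(B * (t - r : ℕ)))) := by gcongr
      _ = _ := by rw [hexp]; ring

theorem IsTreeLevel.approxMixture_one [G.LocallyFinite] {d : ℕ}
    (h : IsTreeLevel G t v lev par) (hG : G.IsRegularOfDegree d) (hd : 1 ≤ d) (hq : 2 ≤ q)
    {β B : ℝ} (hβ : 0 ≤ β) (hB : 0 ≤ B) {r : ℕ} (hr : r + 1 ≤ t) :
    ApproxMixture (levelWeight β B G lev 1 : (V → Fin q) → ℝ)
      {u | lev u ≤ 1} {u | lev u = 1} ((bp d q β B)^[r] 0) ((bp d q β B)^[r] 1)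
      (amplification d q β B (r + 1) * Real.exp (-(B * t))) := by
  have key : ∀ j k, 1 ≤ k → k + j = r + 1 →
      ApproxMixture (levelWeight β B G lev k : (V → Fin q) → ℝ)
        {u | lev u ≤ k} {u | lev u = k} ((bp d q β B)^[j] 0) ((bp d q β B)^[j] 1)
        (d ^ (r + 1) * q * Real.exp (B * (r + 1 : ℕ)) * Real.exp (-(B * t)) *
          ∏ i ∈ Finset.Ico k (r + 1), Real.exp ((B + β) * d ^ (i + 1))) := by
    intro j
    induction j with
    | zero =>
      intro k _ hk
      obtain rfl : k = r + 1 := by omega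
      simpa using h.approxMixture_top (q := q) hG hβ hB hr
    | succ j ih =>
      intro k hk1 hk
      have := h.approxMixture_step hG hd hq hβ hB hk1 (by omega)
        (bp_iterate_mem d hq hβ hB le_rfl zero_le_one j).1
        (iterate_bp_zero_le_one d hq hβ hB j)
        (bp_iterate_mem d hq hβ hB zero_le_one le_rfl j).2
        (by positivity) (ih (k + 1) (by omega) (by omega))
      rw [Function.iterate_succ_apply', Function.iterate_succ_apply',
        Finset.prod_eq_prod_Ico_succ_bot (by omega : k < r + 1)]
      convert this using 1
      ring
  convert key r 1 le_rfl (by omega) using 1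
  rw [amplification]
  ring

end Step

/-! ### The law of the neighbouring spins -/

section Neighbours

variable {V : Type*} [Fintype V] {q : ℕ} [NeZero q]

theorem pottsWeight_pos {W : Type*} [Fintype W] (β B : ℝ) (G : SimpleGraph W) (σ : W → Fin q) :
    0 < pottsWeight β B G σ := by
  classical
  exact mul_pos (Finset.prod_pos fun e _ => edgeWeight_pos β σ e)
    (Finset.prod_pos fun _ _ => psiBar_pos _ _)

theorem pottsZ_eq_sum {W : Type*} [Fintype W] [DecidableEq W] (q : ℕ) [NeZero q] (β B : ℝ)
    (G : SimpleGraph W) : pottsZ q β B G = ∑ σ : W → Fin q, pottsWeight β B G σ := by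
  unfold pottsZ
  congr!

theorem pottsZ_pos {W : Type*} [Fintype W] (q : ℕ) [NeZero q] (β B : ℝ) (G : SimpleGraph W) :
    0 < pottsZ q β B G := by
  classical
  unfold pottsZ
  exact Finset.sum_pos (fun σ _ => pottsWeight_pos β B G σ) Finset.univ_nonempty

open Classical in
theorem nuMinus_nonneg {d : ℕ} (β B : ℝ) (G : SimpleGraph V) (v : V)
    (e : Fin d ≃ G.neighborSet v) (τ : Fin d → Fin q) : 0 ≤ nuMinus β B G v e τ := by
  unfold nuMinus
  refine Finset.sum_nonneg fun σ _ => ?_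
  split_ifs
  · exact div_nonneg (pottsWeight_pos _ _ _ _).le (pottsZ_pos _ _ _ _).le
  · exact le_rfl

open Classical in
theorem sum_nuMinus_mul {d : ℕ} (β B : ℝ) (G : SimpleGraph V) (v : V)
    (e : Fin d ≃ G.neighborSet v) (g : (Fin d → Fin q) → ℝ) :
    ∑ τ, nuMinus β B G v e τ * g τ
      = (∑ σ, pottsWeight β B (G.induce {w : V | w ≠ v}) σ *
          g fun j => σ ⟨(e j : V), (G.ne_of_adj (e j).2).symm⟩)
        / pottsZ q β B (G.induce {w : V | w ≠ v}) := by
  simp only [nuMinus, Finset.sum_mul]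
  rw [Finset.sum_comm, Finset.sum_div]
  refine Finset.sum_congr rfl fun σ _ => ?_
  simp only [← funext_iff, ite_mul, zero_mul]
  rw [Finset.sum_ite_eq, if_pos (Finset.mem_univ _), pottsProb]
  ring

open Classical in
theorem sum_nuMinus {d : ℕ} (β B : ℝ) (G : SimpleGraph V) (v : V)
    (e : Fin d ≃ G.neighborSet v) : ∑ τ : Fin d → Fin q, nuMinus β B G v e τ = 1 := by
  have h := sum_nuMinus_mul (q := q) β B G v e 1
  simp only [Pi.one_apply, mul_one] at h
  rw [h]
  rw [← pottsZ_eq_sum]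
  exact div_self (pottsZ_pos q β B _).ne'

open Classical in
theorem IsTreeLevel.levelWeight_one {G : SimpleGraph V} {t : ℕ} {v : V}
    {lev : V → ℕ} {par : V → V} (h : IsTreeLevel G t v lev par) (β B : ℝ) (σ : V → Fin q) :
    levelWeight β B G lev 1 σ
      = pottsWeight β B (G.induce {w : V | w ≠ v}) fun w => σ w := by
  have hlev : ∀ u, 1 ≤ lev u ↔ u ≠ v := fun u => by
    rw [Nat.one_le_iff_ne_zero, ne_eq, h.eq_zero_iff]
  unfold levelWeight partialWeight pottsWeight
  congr 1
  · have hE : levelEdges G lev 1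
        = (G.induce {w : V | w ≠ v}).edgeFinset.image (Sym2.map Subtype.val) := by
      ext e
      induction e with
      | _ a b =>
        rw [mem_levelEdges, hlev, hlev, Finset.mem_image]
        constructor
        · rintro ⟨hab, ha, hb⟩
          exact ⟨s(⟨a, ha⟩, ⟨b, hb⟩), by simpa using hab, rfl⟩
        · rintro ⟨e, he, hab⟩
          induction e with
          | _ x y =>
            have hxy : G.Adj x.1 y.1 := by simpa using he
            rcases Sym2.eq_iff.1 hab with ⟨rfl, rfl⟩ | ⟨rfl, rfl⟩
            · exact ⟨hxy, x.2, y.2⟩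
            · exact ⟨hxy.symm, y.2, x.2⟩
    rw [hE, Finset.prod_image (Sym2.map.injective Subtype.val_injective).injOn]
    refine Finset.prod_congr rfl fun e _ => ?_
    induction e with
    | _ x y => rfl
  · exact Finset.prod_subtype _ (fun u => by simp [hlev]) fun u => psiBar B (σ u)

open Classical in
theorem sum_comp_restrict {q : ℕ} (v : V) (Ψ : ({w : V | w ≠ v} → Fin q) → ℝ) :
    ∑ σ : V → Fin q, Ψ (fun w => σ w) = q * ∑ σ, Ψ σ := by
  calc ∑ σ : V → Fin q, Ψ (fun w => σ w)
      = ∑ x : Fin q × ({w : V | w ≠ v} → Fin q), Ψ x.2 :=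
        Fintype.sum_equiv (Equiv.funSplitAt v (Fin q)) _ _ fun σ => rfl
    _ = q * ∑ σ, Ψ σ := by simp [Fintype.sum_prod_type]

open Classical in
theorem IsTreeLevel.sum_levelWeight_one {G : SimpleGraph V} {t : ℕ} {v : V}
    {lev : V → ℕ} {par : V → V} (h : IsTreeLevel G t v lev par) (β B : ℝ) {d : ℕ}
    (e : Fin d ≃ G.neighborSet v) (g : (Fin d → Fin q) → ℝ) :
    ∑ σ : V → Fin q, levelWeight β B G lev 1 σ * g (fun j => σ (e j))
      = q * pottsZ q β B (G.induce {w : V | w ≠ v}) * ∑ τ, nuMinus β B G v e τ * g τ := by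
  rw [sum_nuMinus_mul]
  simp only [h.levelWeight_one]
  rw [sum_comp_restrict v fun σ => pottsWeight β B (G.induce {w : V | w ≠ v}) σ *
    g fun j => σ ⟨(e j : V), (G.ne_of_adj (e j).2).symm⟩]
  have := (pottsZ_pos q β B (G.induce {w : V | w ≠ v})).ne'
  field_simp

end Neighbours

/-! ### Total variation and mixtures -/

section Mixtures

theorem tvDist_le_one {Ω : Type*} [Fintype Ω] {μ ν : Ω → ℝ} (hμ : ∀ x, 0 ≤ μ x)
    (hν : ∀ x, 0 ≤ ν x) (hμ1 : ∑ x, μ x = 1) (hν1 : ∑ x, ν x = 1) : tvDist μ ν ≤ 1 := by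
  have h : ∑ x, |μ x - ν x| ≤ ∑ x, (μ x + ν x) := by
    refine Finset.sum_le_sum fun x _ => ?_
    rw [abs_le]
    constructor <;> linarith [hμ x, hν x]
  rw [Finset.sum_add_distrib, hμ1, hν1] at h
  unfold tvDist
  linarith

/-- A probability vector that is `ℓ¹`-close to a non-negative vector `c` is close in total variation
to the normalization of `c`. -/
theorem tvDist_le_of_tests {Ω : Type*} [Fintype Ω] {μ c : Ω → ℝ} {δ : ℝ}
    (hc : ∀ x, 0 ≤ c x) (hμ1 : ∑ x, μ x = 1) (hW : 0 < ∑ x, c x)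
    (h : ∀ g : Ω → ℝ, (∀ x, |g x| ≤ 1) → |∑ x, μ x * g x - ∑ x, c x * g x| ≤ δ) :
    tvDist μ (fun x => c x / ∑ y, c y) ≤ δ := by
  set W := ∑ y, c y with hWdef
  have h1 : ∑ x, |μ x - c x| ≤ δ := by
    refine le_trans (le_of_eq ?_) ((le_abs_self _).trans
      (h (fun x => if 0 ≤ μ x - c x then 1 else -1) fun x => by split_ifs <;> simp))
    rw [← Finset.sum_sub_distrib]
    refine Finset.sum_congr rfl fun x _ => ?_
    split_ifs with hx
    · rw [abs_of_nonneg hx]; ring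
    · rw [abs_of_neg (not_le.1 hx)]; ring
  have h2 : |1 - W| ≤ δ := by
    have := h 1 (by simp)
    simpa [hμ1] using this
  have h3 : ∑ x, |c x - c x / W| = |1 - W| := by
    have h4 : ∀ x, |c x - c x / W| = c x * (|1 - W| / W) := by
      intro x
      have : c x - c x / W = c x * (-(1 - W) / W) := by field_simp; ring
      rw [this, abs_mul, abs_div, abs_neg, abs_of_nonneg (hc x), abs_of_pos hW]
    simp only [h4]
    rw [← Finset.sum_mul, ← hWdef]
    field_simp
  have h5 : ∑ x, |μ x - c x / W| ≤ ∑ x, |μ x - c x| + ∑ x, |c x - c x / W| := by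
    rw [← Finset.sum_add_distrib]
    exact Finset.sum_le_sum fun x _ => abs_sub_le _ _ _
  unfold tvDist
  linarith

theorem exists_measure_of_weights {ι E : Type*} [Fintype ι] [MeasurableSpace E]
    [MeasurableSingletonClass E] (w : ι → ℝ) (hw : ∀ i, 0 ≤ w i) (hw1 : ∑ i, w i = 1)
    (x : ι → E) :
    ∃ ρ : Measure E, IsProbabilityMeasure ρ ∧ (∀ p : E → Prop, (∀ i, p (x i)) → ∀ᵐ y ∂ρ, p y) ∧
      ∀ F : E → ℝ, ∫ y, F y ∂ρ = ∑ i, w i * F (x i) := by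
  refine ⟨∑ i, ENNReal.ofReal (w i) • Measure.dirac (x i), ⟨?_⟩, ?_, ?_⟩
  · simp only [Measure.coe_finsetSum, Measure.coe_smul, Finset.sum_apply, Pi.smul_apply,
      measure_univ, smul_eq_mul, mul_one]
    rw [← ENNReal.ofReal_sum_of_nonneg fun i _ => hw i, hw1, ENNReal.ofReal_one]
  · intro p hp
    rw [ae_iff, Measure.coe_finsetSum, Finset.sum_apply]
    refine Finset.sum_eq_zero fun i _ => ?_
    rw [Measure.smul_apply, Measure.dirac_apply]
    simp [hp i]
  · intro F
    rw [integral_finsetSum_measure]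
    · refine Finset.sum_congr rfl fun i _ => ?_
      rw [integral_smul_measure, integral_dirac, ENNReal.toReal_ofReal (hw i), smul_eq_mul]
    · intro i _
      exact (integrable_dirac (by simp)).smul_measure ENNReal.ofReal_ne_top

variable {q : ℕ} [NeZero q]

theorem sum_prod_biasVec {d : ℕ} (b : Fin d → ℝ) :
    ∑ τ : Fin d → Fin q, ∏ j, biasVec q (b j) (τ j) = 1 := by
  rw [← Fintype.prod_sum fun j s => biasVec q (b j) s]
  simp [sum_biasVec]

end Mixtures

/-! ### Mixtures at a single vertex -/

section Vertex

variable {V : Type*} [Fintype V] {q : ℕ} [NeZero q]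

/-- At a vertex with a tree ball the approximate mixture at level `1`, normalized, is the mixture of
product measures that the theorem asks for. -/
theorem exists_measure_of_isTreeBall {d : ℕ} (hd : 1 ≤ d) (hq : 2 ≤ q) {β B : ℝ} (hβ : 0 ≤ β)
    (hB : 0 ≤ B) (G : SimpleGraph V) [G.LocallyFinite] (hG : G.IsRegularOfDegree d) {v : V}
    (e : Fin d ≃ G.neighborSet v) {r t : ℕ} (hr : r + 1 ≤ t) (hv : IsTreeBall d G t v)
    (hδ : amplification d q β B (r + 1) * Real.exp (-(B * t)) < 1) :
    ∃ ρ : Measure (Fin d → Fin q → ℝ), IsProbabilityMeasure ρ ∧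
      (∀ᵐ h ∂ρ, ∀ j, ∃ b, (bp d q β B)^[r] 0 ≤ b ∧ b ≤ (bp d q β B)^[r] 1 ∧ h j = biasVec q b) ∧
      tvDist (nuMinus β B G v e) (mixture ρ)
        ≤ amplification d q β B (r + 1) * Real.exp (-(B * t)) := by
  classical
  obtain ⟨lev, par, h⟩ := hv.exists_level
  obtain ⟨w, b, hw, hb, hf⟩ := h.approxMixture_one (q := q) hG hd hq hβ hB hr
  set δ := amplification d q β B (r + 1) * Real.exp (-(B * t))
  set S : Finset V := {u | lev u = 1} with hS
  set K : ℝ := q * pottsZ q β B (G.induce {w : V | w ≠ v}) with hKdef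
  have hq0 : (0 : ℝ) < q := by exact_mod_cast (by omega : 0 < q)
  have hK : 0 < K := mul_pos hq0 (pottsZ_pos q β B _)
  have heS : ∀ j, (e j : V) ∈ S := fun j => by
    simpa [hS] using (h.adj_root_iff (by omega) _).1 (e j).2
  have hinj : Function.Injective fun j => (e j : V) :=
    Subtype.val_injective.comp e.injective
  let w' : Finset (Sym2 V) → ℝ := fun η => K⁻¹ * (q : ℝ) ^ Sᶜ.card * w η
  have hw' : ∀ η, 0 ≤ w' η := fun η => mul_nonneg (by positivity) (hw η)
  let P : Finset (Sym2 V) → (Fin d → Fin q) → ℝ := fun η τ => ∏ j, biasVec q (b η (e j)) (τ j)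
  have hbj : ∀ η j, 0 ≤ b η (e j) ∧ b η (e j) ≤ 1 := fun η j =>
    ⟨(bp_iterate_mem d hq hβ hB le_rfl zero_le_one r).1.trans (hb η _ (heS j)).1,
      (hb η _ (heS j)).2.trans (bp_iterate_mem d hq hβ hB zero_le_one le_rfl r).2⟩
  have hP : ∀ η τ, 0 ≤ P η τ := fun η τ =>
    Finset.prod_nonneg fun j _ => biasVec_nonneg (hbj η j).1 (hbj η j).2 _
  have hmix : ∀ g : (Fin d → Fin q) → ℝ,
      ∑ η, w η * ∑ σ : V → Fin q, (∏ u ∈ S, biasVec q (b η u) (σ u)) * g (fun j => σ (e j))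
        = K * ∑ τ, (∑ η, w' η * P η τ) * g τ := by
    intro g
    simp only [Finset.sum_mul]
    rw [Finset.sum_comm, Finset.mul_sum]
    refine Finset.sum_congr rfl fun η _ => ?_
    have h1 := prod_biasVec_extend (b η) subset_rfl (fun u hu hu' => absurd hu hu')
      (fun σ : V → Fin q => g fun j => σ (e j)) (U := S) (S := S)
      (fun σ τ hστ => by
        have : (fun j => σ (e j)) = fun j => τ (e j) := funext fun j => hστ _ (heS j)
        simp only [this])
    have h2 := sum_prod_mul_comp_injective hinj (fun u s => biasVec q (b η u) s)
      (fun u => sum_biasVec _) g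
    have h3 : ∑ τ, w' η * P η τ * g τ = w' η * ∑ τ, P η τ * g τ := by
      rw [Finset.mul_sum]
      exact Finset.sum_congr rfl fun τ _ => by ring
    have h4 : ∑ τ, P η τ * g τ = (1 / (q : ℝ)) ^ Sᶜ.card *
        ∑ σ : V → Fin q, (∏ u ∈ S, biasVec q (b η u) (σ u)) * g (fun j => σ (e j)) := by
      rw [← h1]
      exact h2.symm
    rw [h3, h4]
    simp only [w']
    rw [one_div, inv_pow]
    field_simp
  have hsum : ∀ g : (Fin d → Fin q) → ℝ, (∀ τ, |g τ| ≤ 1) →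
      |∑ τ, nuMinus β B G v e τ * g τ - ∑ τ, (∑ η, w' η * P η τ) * g τ| ≤ δ := by
    intro g hg
    have h1 := hf (fun σ => g fun j => σ (e j))
      (fun σ τ hστ => by
        have : (fun j => σ (e j)) = fun j => τ (e j) := funext fun j => hστ _ (by
          have := heS j
          simp only [hS, Finset.mem_filter, Finset.mem_univ, true_and] at this ⊢
          omega)
        simp only [this])
      (fun σ => hg _)
    have h2 := h.sum_levelWeight_one β B e (1 : (Fin d → Fin q) → ℝ)
    simp only [Pi.one_apply, mul_one, sum_nuMinus] at h2
    rw [h.sum_levelWeight_one β B e g, hmix g, h2, ← hKdef, ← mul_sub, abs_mul, abs_of_pos hK,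
      mul_comm δ] at h1
    exact le_of_mul_le_mul_left h1 hK
  have htot : ∑ τ, ∑ η, w' η * P η τ = ∑ η, w' η := by
    rw [Finset.sum_comm]
    refine Finset.sum_congr rfl fun η _ => ?_
    rw [← Finset.mul_sum, sum_prod_biasVec, mul_one]
  have hW : 0 < ∑ η, w' η := by
    have h1 := hsum 1 (by simp)
    simp only [Pi.one_apply, mul_one, sum_nuMinus, htot] at h1
    linarith [le_abs_self (1 - ∑ η, w' η)]
  obtain ⟨ρ, hρ, hae, hint⟩ := exists_measure_of_weights (fun η => w' η / ∑ η, w' η)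
    (fun η => div_nonneg (hw' η) hW.le) (by rw [← Finset.sum_div, div_self hW.ne'])
    (fun η (j : Fin d) => (biasVec q (b η (e j)) : Fin q → ℝ))
  refine ⟨ρ, hρ, hae _ fun η j => ⟨_, (hb η _ (heS j)).1, (hb η _ (heS j)).2, rfl⟩, ?_⟩
  have hmixρ : mixture ρ = fun τ => (∑ η, w' η * P η τ) / ∑ τ, ∑ η, w' η * P η τ := by
    funext τ
    rw [mixture, hint, htot, Finset.sum_div]
    exact Finset.sum_congr rfl fun η _ => by simp only [P]; ring
  rw [hmixρ]
  exact tvDist_le_of_tests (fun τ => Finset.sum_nonneg fun η _ => mul_nonneg (hw' η) (hP η τ))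
    (sum_nuMinus β B G v e) (htot ▸ hW) hsum

theorem biasF_le_biasM (d : ℕ) (hq : 2 ≤ q) {β B : ℝ} (hβ : 0 ≤ β) (hB : 0 ≤ B) :
    biasF d q β B ≤ biasM d q β B :=
  le_of_tendsto_of_tendsto' (tendsto_biasF d hq hβ hB) (tendsto_biasM d hq hβ hB)
    (iterate_bp_zero_le_one d hq hβ hB)

/-- At the remaining vertices any measure does, since the total variation distance is at most one. -/
theorem exists_measure_of_nonneg {d : ℕ} (hq : 2 ≤ q) {β B : ℝ} (hβ : 0 ≤ β) (hB : 0 ≤ B)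
    (G : SimpleGraph V) {v : V} (e : Fin d ≃ G.neighborSet v) {ε : ℝ} (hε : 0 ≤ ε) :
    ∃ ρ : Measure (Fin d → Fin q → ℝ), IsProbabilityMeasure ρ ∧
      (∀ᵐ h ∂ρ, ∀ j, h j ∈ simplexFK d q β B ε) ∧
      tvDist (nuMinus β B G v e) (mixture ρ) ≤ 1 := by
  have h0 : 0 ≤ biasF d q β B := ge_of_tendsto' (tendsto_biasF d hq hβ hB)
    fun n => (bp_iterate_mem d hq hβ hB le_rfl zero_le_one n).1
  have h1 : biasF d q β B ≤ 1 := le_of_tendsto' (tendsto_biasF d hq hβ hB)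
    fun n => (bp_iterate_mem d hq hβ hB le_rfl zero_le_one n).2
  obtain ⟨ρ, hρ, hae, hint⟩ := exists_measure_of_weights (ι := Unit) (fun _ => 1)
    (fun _ => zero_le_one) (by simp)
    (fun _ (_ : Fin d) => (biasVec q (biasF d q β B) : Fin q → ℝ))
  refine ⟨ρ, hρ, hae _ fun _ j => ⟨_, h0, h1, by linarith,
    by linarith [biasF_le_biasM d hq hβ hB], rfl⟩, ?_⟩
  have hmix : mixture ρ = fun τ => ∏ j, biasVec q (biasF d q β B) (τ j) := by
    funext τ
    rw [mixture, hint]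
    simp
  rw [hmix]
  exact tvDist_le_one (nuMinus_nonneg β B G v e)
    (fun τ => Finset.prod_nonneg fun j _ => biasVec_nonneg h0 h1 _)
    (sum_nuMinus β B G v e) (sum_prod_biasVec fun _ => biasF d q β B)

end Vertex

/-! ### The error functions -/

/-- A depth growing so slowly that `a`, evaluated along it, grows at most like `exp (B t / 2)`. -/
theorem exists_slow_depth (a : ℕ → ℝ) {B : ℝ} (hB : 0 < B) :
    ∃ R : ℕ → ℕ, (∀ t, R t ≤ t) ∧ (∀ t, R t ≠ 0 → a (R t) ≤ Real.exp (B * t / 2)) ∧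
      Tendsto R atTop atTop := by
  classical
  refine ⟨fun t => Nat.findGreatest (fun r => a r ≤ Real.exp (B * t / 2)) t,
    fun t => Nat.findGreatest_le t, fun t ht => Nat.findGreatest_of_ne_zero rfl ht, ?_⟩
  rw [tendsto_atTop]
  intro n
  have h1 : Tendsto (fun t : ℕ => Real.exp (B * t / 2)) atTop atTop :=
    Real.tendsto_exp_atTop.comp
      ((tendsto_natCast_atTop_atTop.const_mul_atTop hB).atTop_div_const two_pos)
  filter_upwards [h1.eventually_ge_atTop (a n), eventually_ge_atTop n] with t ht hnt
  exact Nat.le_findGreatest hnt ht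

theorem isError_min_add_min {δ : ℕ → ℝ} (hδ0 : ∀ t, 0 ≤ δ t) (hδ : Tendsto δ atTop (𝓝 0)) :
    IsError fun t x => min 1 (δ t) + min 1 x := by
  refine ⟨⟨2, fun t x hx => ?_⟩, fun t => min 1 (δ t), fun t => ?_, ?_⟩
  · rw [abs_of_nonneg (add_nonneg (le_min zero_le_one (hδ0 t)) (le_min zero_le_one hx))]
    linarith [min_le_left 1 (δ t), min_le_left 1 x]
  · have h : Continuous fun x : ℝ => min 1 (δ t) + min 1 x := by fun_prop
    have h0 := (h.tendsto 0).mono_left (nhdsWithin_le_nhds (s := Set.Ici 0))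
    simpa using h0
  · simpa using (tendsto_const_nhds (x := (1 : ℝ))).min hδ

end PottsTree

end

open PottsTree in
theorem propositionp (d q : ℕ) [NeZero q] (hd : 3 ≤ d) (hq : 2 ≤ q) (β B : ℝ)
    (hβ : 0 ≤ β) (hB : 0 < B) :
    ∃ (ε : ℕ → ℝ) (err : ℕ → ℝ → ℝ),
      Tendsto ε atTop (𝓝 0) ∧ PottsTree.IsError err ∧
      ∀ (V : Type*) [Fintype V] [Nonempty V] (G : SimpleGraph V) [G.LocallyFinite],
        G.IsRegularOfDegree d →
        ∀ e : (v : V) → (Fin d ≃ G.neighborSet v),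
          ∃ ρ : V → ℕ → Measure (Fin d → Fin q → ℝ),
            (∀ v t, IsProbabilityMeasure (ρ v t) ∧
              ∀ᵐ h ∂(ρ v t), ∀ j, h j ∈ PottsTree.simplexFK d q β B (ε t)) ∧
            ∀ t, (∑ v : V, PottsTree.tvDist (PottsTree.nuMinus β B G v (e v))
                (PottsTree.mixture (ρ v t))) / (Fintype.card V : ℝ)
              ≤ err t (PottsTree.zeta d t G) := by
  have hd1 : 1 ≤ d := by omega
  obtain ⟨R, hRt, hRa, hR⟩ := exists_slow_depth (amplification d q β B) hB
  have hR1 : Tendsto (fun t => R t - 1) atTop atTop := (tendsto_sub_atTop_nat 1).comp hR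
  have hamp : ∀ r, 0 ≤ amplification d q β B r := fun r => by unfold amplification; positivity
  set ε : ℕ → ℝ := fun t => max 0 (max (biasF d q β B - (bp d q β B)^[R t - 1] 0)
    ((bp d q β B)^[R t - 1] 1 - biasM d q β B)) with hε
  -- Where the depth is zero the bound is the trivial one.
  set δ : ℕ → ℝ := fun t =>
    if R t = 0 then 1 else amplification d q β B (R t) * Real.exp (-(B * t)) with hδ
  have hδ0 : ∀ t, 0 ≤ δ t := fun t => by
    simp only [hδ]
    split_ifs
    · exact zero_le_one
    · exact mul_nonneg (hamp _) (Real.exp_pos _).le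
  have hε_lim : Tendsto ε atTop (𝓝 0) := by
    have h1 := ((tendsto_biasF d hq hβ hB.le).comp hR1).const_sub (biasF d q β B)
    have h2 := ((tendsto_biasM d hq hβ hB.le).comp hR1).sub_const (biasM d q β B)
    simpa using (tendsto_const_nhds (x := (0 : ℝ))).max (h1.max h2)
  have hδ_lim : Tendsto δ atTop (𝓝 0) := by
    have h1 : Tendsto (fun t : ℕ => Real.exp (-(B * t / 2))) atTop (𝓝 0) :=
      Real.tendsto_exp_neg_atTop_nhds_zero.comp
        ((tendsto_natCast_atTop_atTop.const_mul_atTop hB).atTop_div_const two_pos)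
    refine squeeze_zero' (.of_forall hδ0) ?_ h1
    filter_upwards [hR.eventually_ge_atTop 1] with t ht
    have ht0 : R t ≠ 0 := by omega
    simp only [hδ, if_neg ht0]
    calc amplification d q β B (R t) * Real.exp (-(B * t))
        ≤ Real.exp (B * t / 2) * Real.exp (-(B * t)) :=
          mul_le_mul_of_nonneg_right (hRa t ht0) (Real.exp_pos _).le
      _ = Real.exp (-(B * t / 2)) := by
          rw [← Real.exp_add]
          congr 1
          ring
  refine ⟨ε, fun t x => min 1 (δ t) + min 1 x, hε_lim, isError_min_add_min hδ0 hδ_lim, ?_⟩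
  intro V _ _ G _ hG e
  classical
  have hex : ∀ v t, ∃ ρ : Measure (Fin d → Fin q → ℝ), (IsProbabilityMeasure ρ ∧
      ∀ᵐ h ∂ρ, ∀ j, h j ∈ simplexFK d q β B (ε t)) ∧
      tvDist (nuMinus β B G v (e v)) (mixture ρ)
        ≤ min 1 (δ t) + if IsTreeBall d G t v then 0 else 1 := by
    intro v t
    have hε0 : 0 ≤ ε t := le_max_left _ _
    by_cases hv : IsTreeBall d G t v ∧ δ t < 1
    · obtain ⟨hv, hδ1⟩ := hv
      have hR0 : R t ≠ 0 := fun h => by simp [hδ, h] at hδ1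
      have hRt1 : R t - 1 + 1 = R t := by omega
      have hδt : δ t = amplification d q β B (R t - 1 + 1) * Real.exp (-(B * t)) := by
        simp only [hδ, if_neg hR0, hRt1]
      obtain ⟨ρ, hρ, hae, htv⟩ := exists_measure_of_isTreeBall hd1 hq hβ hB.le G hG (e v)
        (r := R t - 1) (hRt1.trans_le (hRt t)) hv (hδt ▸ hδ1)
      refine ⟨ρ, ⟨hρ, ?_⟩, ?_⟩
      · filter_upwards [hae] with h hh j
        obtain ⟨b, hb0, hb1, hb⟩ := hh j
        refine ⟨b, (bp_iterate_mem d hq hβ hB.le le_rfl zero_le_one _).1.trans hb0,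
          hb1.trans (bp_iterate_mem d hq hβ hB.le zero_le_one le_rfl _).2, ?_, ?_, hb⟩
        · have : biasF d q β B - (bp d q β B)^[R t - 1] 0 ≤ ε t :=
            (le_max_left _ _).trans (le_max_right _ _)
          linarith
        · have : (bp d q β B)^[R t - 1] 1 - biasM d q β B ≤ ε t :=
            (le_max_right _ _).trans (le_max_right _ _)
          linarith
      · rw [if_pos hv, add_zero, min_eq_right hδ1.le, hδt]
        exact htv
    · obtain ⟨ρ, hρ, hae, htv⟩ := exists_measure_of_nonneg hq hβ hB.le G (e v) hε0
      refine ⟨ρ, ⟨hρ, hae⟩, htv.trans ?_⟩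
      split_ifs with hT
      · rw [min_eq_left (not_lt.1 fun h => hv ⟨hT, h⟩), add_zero]
      · linarith [le_min zero_le_one (hδ0 t)]
  choose ρ hρ htv using hex
  refine ⟨ρ, hρ, fun t => ?_⟩
  have hcard : (0 : ℝ) < Fintype.card V := by exact_mod_cast Fintype.card_pos
  have hncard : ({v : V | ¬ IsTreeBall d G t v}.ncard : ℝ)
      = ∑ v : V, if IsTreeBall d G t v then (0 : ℝ) else 1 := by
    rw [Set.ncard_eq_toFinset_card', Set.toFinset_ofPred, Finset.card_filter]
    push_cast
    exact Finset.sum_congr rfl fun v _ => by split_ifs <;> simp_all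
  have hzeta : zeta d t G ≤ 1 := by
    rw [zeta, div_le_one hcard]
    exact_mod_cast (Set.ncard_le_card _).trans_eq Nat.card_eq_fintype_card
  change _ ≤ min 1 (δ t) + min 1 (zeta d t G)
  rw [min_eq_right hzeta, zeta, div_le_iff₀ hcard, add_mul, div_mul_cancel₀ _ hcard.ne', hncard]
  calc ∑ v : V, tvDist (nuMinus β B G v (e v)) (mixture (ρ v t))
      ≤ ∑ v : V, (min 1 (δ t) + if IsTreeBall d G t v then 0 else 1) :=
        Finset.sum_le_sum fun v _ => htv v t
    _ = _ := by
        rw [Finset.sum_add_distrib, Finset.sum_const, Finset.card_univ, nsmul_eq_mul, mul_comm]
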